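/- Let $n>k\geq 1$ be integers and let $\mathfrak{C}_{k,n-k}=\mathbb{Z}^2/(-(n-k),k)\mathbb{Z}$ be the cylinder with $k$ rows and $n-k$ columns. Write $\langle i,j\rangle$ for the class of $(i,j)$, and let the cylinder carry the order inherited from $\mathbb{Z}^2$, generated by $\langle i,j\rangle<\langle i+1,j\rangle$ and $\langle i,j\rangle<\langle i,j+1\rangle$. A cylindric skew shape is a finite convex subposet $C$ of $\mathfrak{C}_{k,n-k}$. Its $q$-th column is $\{\langle q,j\rangle\in C : j\in\mathbb{Z}\}$ and its $p$-th row is $\{\langle i,p\rangle\in C : i\in\mathbb{Z}\}$. $C$ is toric if each of its columns contains at most $k$ elements. The cylindric skew Schur function is $s_C(x_1,x_2,\dots)=\sum_T\prod_{c\in C}x_{T(c)}$, where the sum is over all maps $T:C\to\{1,2,\dots\}$ that weakly increase along rows and strictly increase along columns. We regard $C$ as an oriented poset, i.e. a poset whose Hasse diagram edges are designated strict or weak: the vertical edges $\langle i,j\rangle<\langle i,j+1\rangle$ are strict and the other edges are weak. A skew shape $\lambda/\mu$ (for partitions $\mu\subseteq\lambda$) is likewise the oriented poset of its boxes, ordered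 componentwise by (row, column), with edges between vertically adjacent boxes strict and edges between horizontally adjacent boxes weak. $C$ is isomorphic to a skew shape if, for some $\lambda/\mu$, there is a poset isomorphism from $C$ to $\lambda/\mu$ that sends strict edges to strict edges and weak edges to weak edges. A power series $f(x_1,x_2,\dots)$ is Schur-positive in $N$ variables if $f(x_1,\dots,x_N,0,0,\dots)$ is a finite linear combination, with non-negative coefficients, of Schur polynomials $s_\nu(x_1,\dots,x_N)$, where $\nu$ ranges over partitions with at most $N$ parts. Corollary. If $C\subseteq\mathfrak{C}_{k,n-k}$ is a toric shape that is not isomorphic to a skew shape, then $s_C$ is not Schur-positive in $2k+1$ variables. -/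

import Mathlib

/-- The cylinder with `v` rows and `u` columns: the quotient of the lattice `ℤ × ℤ`
by the subgroup generated by `(-u, v)`.  The first coordinate of a lattice point is its column
index, the second one is its row index. -/
def Cylinder (v u : ℕ) : Type :=
  (ℤ × ℤ) ⧸ AddSubgroup.zmultiples ((-(u : ℤ), (v : ℤ)) : ℤ × ℤ)

namespace Cylinder

/-- The class `⟨i, j⟩` of the lattice point `(i, j)`. -/
def mk (v u : ℕ) (i j : ℤ) : Cylinder v u :=
  QuotientAddGroup.mk ((i, j) : ℤ × ℤ)

theorem mk_eq_mk_iff {v u : ℕ} {i j i' j' : ℤ} :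
    mk v u i j = mk v u i' j' ↔ ∃ t : ℤ, i' = i - t * u ∧ j' = j + t * v := by
  refine (QuotientAddGroup.eq (s := AddSubgroup.zmultiples ((-(u : ℤ), (v : ℤ)) : ℤ × ℤ))).trans ?_
  rw [AddSubgroup.mem_zmultiples_iff]
  constructor
  · rintro ⟨t, ht⟩
    simp only [Prod.smul_mk, Prod.neg_mk, Prod.mk_add_mk, Prod.mk.injEq, smul_eq_mul] at ht
    exact ⟨t, by linarith [ht.1], by linarith [ht.2]⟩
  · rintro ⟨t, h1, h2⟩
    refine ⟨t, ?_⟩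
    simp only [Prod.smul_mk, Prod.neg_mk, Prod.mk_add_mk, Prod.mk.injEq, smul_eq_mul]
    exact ⟨by linarith, by linarith⟩

/-- The order inherited from the componentwise order of `ℤ × ℤ`: `x ≤ y` if some lattice point
over `x` is componentwise at most some lattice point over `y`.  This is the reflexive transitive
relation generated by `⟨i, j⟩ ≤ ⟨i + 1, j⟩` and `⟨i, j⟩ ≤ ⟨i, j + 1⟩`. -/
instance (v u : ℕ) : Preorder (Cylinder v u) where
  le x y := ∃ i j i' j' : ℤ, x = mk v u i j ∧ y = mk v u i' j' ∧ i ≤ i' ∧ j ≤ j'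
  le_refl x := by
    obtain ⟨⟨i, j⟩, rfl⟩ := QuotientAddGroup.mk_surjective x
    exact ⟨i, j, i, j, rfl, rfl, le_rfl, le_rfl⟩
  le_trans := by
    rintro x y z ⟨i, j, i', j', rfl, rfl, h1, h2⟩ ⟨a, b, a', b', hy, rfl, h3, h4⟩
    obtain ⟨t, rfl, rfl⟩ := mk_eq_mk_iff.1 hy
    exact ⟨i, j, a' + t * u, b' - t * v, rfl,
      mk_eq_mk_iff.2 ⟨-t, by ring, by ring⟩, by linarith, by linarith⟩

/-- For positive `u` and `v` the preorder is a partial order. -/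
theorem le_antisymm' {v u : ℕ} (hv : 0 < v) (hu : 0 < u) {x y : Cylinder v u}
    (hxy : x ≤ y) (hyx : y ≤ x) : x = y := by
  obtain ⟨i, j, i', j', rfl, rfl, h1, h2⟩ := hxy
  obtain ⟨a, b, a', b', hy, hx, h3, h4⟩ := hyx
  obtain ⟨t, rfl, rfl⟩ := mk_eq_mk_iff.1 hy
  obtain ⟨s, rfl, rfl⟩ := mk_eq_mk_iff.1 hx
  have hu' : (0 : ℤ) < u := by exact_mod_cast hu
  have hv' : (0 : ℤ) < v := by exact_mod_cast hv
  have e1 : s ≤ t := by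
    by_contra hlt
    have : t + 1 ≤ s := by omega
    nlinarith
  have e2 : t ≤ s := by
    by_contra hlt
    have : s + 1 ≤ t := by omega
    nlinarith
  obtain rfl : s = t := _root_.le_antisymm e1 e2
  have hi : i = i' := by linarith
  have hj : j = j' := by linarith
  rw [hi, hj]

end Cylinder

/-- A cylindric skew shape: a finite convex subposet of the cylinder. -/
structure CylindricSkewShape (v u : ℕ) where
  cells : Finset (Cylinder v u)
  convex : (cells : Set (Cylinder v u)).OrdConnected

namespace CylindricSkewShape

variable {v u : ℕ}

/-- The `q`-th column of a cylindric skew shape. -/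
def column (C : CylindricSkewShape v u) (q : ℤ) : Set (Cylinder v u) :=
  {c | c ∈ C.cells ∧ ∃ j : ℤ, c = Cylinder.mk v u q j}

/-- A cylindric skew shape on the cylinder with `v` rows is toric if each of its columns contains
at most `v` elements. -/
def IsToric (C : CylindricSkewShape v u) : Prop :=
  ∀ q : ℤ, (C.column q).ncard ≤ v

/-- A semistandard cylindric tableau of shape `C`: weakly increasing along rows, strictly
increasing along columns.  The entries are natural numbers, the entry `a` standing for the positive
integer `a + 1`. -/
structure Tableau (C : CylindricSkewShape v u) where
  entry : {c // c ∈ C.cells} → ℕ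
  row_weak : ∀ (i i' j : ℤ) (h : Cylinder.mk v u i j ∈ C.cells)
    (h' : Cylinder.mk v u i' j ∈ C.cells), i < i' → entry ⟨_, h⟩ ≤ entry ⟨_, h'⟩
  col_strict : ∀ (i j j' : ℤ) (h : Cylinder.mk v u i j ∈ C.cells)
    (h' : Cylinder.mk v u i j' ∈ C.cells), j < j' → entry ⟨_, h⟩ < entry ⟨_, h'⟩

/-- The content of a tableau: the number of occurrences of each entry. -/
noncomputable def Tableau.content {C : CylindricSkewShape v u} (T : C.Tableau) : ℕ →₀ ℕ :=
  ∑ c : {c // c ∈ C.cells}, Finsupp.single (T.entry c) 1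

/-- The cylindric skew Schur function, a formal power series in the variables `x₀, x₁, x₂, …`:
the coefficient of a monomial is the number of semistandard cylindric tableaux with that content. -/
noncomputable def schur (C : CylindricSkewShape v u) : MvPowerSeries ℕ ℚ :=
  fun m => (Nat.card {T : C.Tableau // T.content = m} : ℚ)

/-- The vertical edges `⟨i, j⟩ < ⟨i, j + 1⟩` of `C`, which are the strict ones. -/
def StrictEdge (C : CylindricSkewShape v u) (a b : {c // c ∈ C.cells}) : Prop :=
  ∃ i j : ℤ, a.1 = Cylinder.mk v u i j ∧ b.1 = Cylinder.mk v u i (j + 1)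

end CylindricSkewShape

/-- The boxes of the skew shape `lam / mu`, as pairs (row, column), with the componentwise order. -/
abbrev SkewCells (lam mu : YoungDiagram) : Type :=
  {c : ℕ × ℕ // c ∈ lam ∧ c ∉ mu}

/-- The strict edges of a skew shape: those between vertically adjacent boxes. -/
def SkewCells.StrictEdge {lam mu : YoungDiagram} (a b : SkewCells lam mu) : Prop :=
  b.1.1 = a.1.1 + 1 ∧ b.1.2 = a.1.2

/-- Isomorphism of oriented posets: an order isomorphism that sends strict edges of the Hasse
diagram to strict edges and weak (that is, non-strict) edges to weak edges. -/
def OrientedIso {P Q : Type} [Preorder P] [Preorder Q]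
    (strictP : P → P → Prop) (strictQ : Q → Q → Prop) : Prop :=
  ∃ e : P ≃o Q, ∀ a b : P, a ⋖ b → (strictP a b ↔ strictQ (e a) (e b))

/-- A cylindric skew shape is isomorphic to a skew shape if its oriented poset is isomorphic to that
of `lam / mu` for some partitions `mu ⊆ lam`. -/
def CylindricSkewShape.IsIsoToSkewShape {v u : ℕ} (C : CylindricSkewShape v u) : Prop :=
  ∃ lam mu : YoungDiagram, mu ≤ lam ∧
    OrientedIso C.StrictEdge (SkewCells.StrictEdge (lam := lam) (mu := mu))

/-- The content of a semistandard Young tableau. -/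
noncomputable def ssytContent {nu : YoungDiagram} (T : SemistandardYoungTableau nu) : ℕ →₀ ℕ :=
  ∑ c ∈ nu.cells, Finsupp.single (T c.1 c.2) 1

/-- The Schur function of a partition, in the variables `x₀, x₁, x₂, …`. -/
noncomputable def schurFunction (nu : YoungDiagram) : MvPowerSeries ℕ ℚ :=
  fun m => (Nat.card {T : SemistandardYoungTableau nu // ssytContent T = m} : ℚ)

/-- The specialization `f(x₀, …, x_{N-1}) = f(x₀, …, x_{N-1}, 0, 0, …)`. -/
noncomputable def specializeVars (N : ℕ) (f : MvPowerSeries ℕ ℚ) : MvPowerSeries (Fin N) ℚ :=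
  fun m => MvPowerSeries.coeff (m.mapDomain (fun i : Fin N => (i : ℕ))) f

/-- `f` is Schur-positive in `N` variables: `f(x₀, …, x_{N-1})` is a linear combination, with
non-negative coefficients, of the Schur polynomials `s_ν(x₀, …, x_{N-1})` of partitions `ν` with at
most `N` parts (these polynomials are linearly independent). -/
def SchurPositiveInVars (N : ℕ) (f : MvPowerSeries ℕ ℚ) : Prop :=
  ∃ c : YoungDiagram →₀ ℚ, (∀ nu, 0 ≤ c nu) ∧ (∀ nu ∈ c.support, nu.colLen 0 ≤ N) ∧
    specializeVars N f = c.sum fun nu a => a • specializeVars N (schurFunction nu)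

/-! If two neighbouring columns of C share no row, C can be cut between them and unrolled into a
skew shape (`isIsoToSkewShape_of_cut`). Hence all neighbouring columns overlap. Cut C at a pair with
the smallest overlap, p + 1. This gives a skew shape D with k + p + 1 rows and the same number u of
columns, and the tableaux of C are the tableaux of D that also satisfy the row condition between the
last column and the first one moved up by k rows (`coeff_schur`). Let q > p be the smallest overlap
among the remaining pairs; toricity gives q ≤ k.

The coefficient of a Schur polynomial is read off by an alternating sum of monomial coefficients
(`altCoeff`, `altSum`). As in Stembridge's proof of the Littlewood–Richardson rule, Bender–Knuth
involutions on the columns left of the last failure of the lattice condition cancel everything but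
the Littlewood–Richardson tableaux (`sum_altSum_eq_sum_isLattice`). So the functional is
non-negative on every Schur polynomial, and it suffices to find ν at which its value on s_C is
negative.

That value is the sum over all tableaux of D minus the sum over those that are not wrapped. The
first sum vanishes as soon as ν has more parts than D has rows (`sum_altSum_eq_zero`). For the
second, take ν = μ + (1^p), where the first q parts of μ equal u - 1. In a contributing tableau
every column then contains 0, …, p - 1, so the wrap condition fails exactly in the last of the p + 1
common rows. What remains of the last column can be stacked below the first column, and cutting at
the overlap q turns the result into a tableau of a skew shape E with u - 1 columns and k + q + 1
rows. This is a bijection on contributing tableaux that respects the alternating sums for ν and μ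
(`sum_not_isWrapped`).

Finally, E has a Littlewood–Richardson tableau that uses k + q + 1 letters, the first q of them in
every column (`exists_lattice_merged`). For its weight μ the second sum is at least 1, while ν has
more than k + p + 1 parts, so the value on s_C is negative. All this needs only k + q + 1 ≤ 2k + 1
variables. -/

/-! ### Run reversal -/

/-- `c'` lies in the same run as `c`, where consecutive integers `y`, `y + 1` are glued
when `link y`. -/
def SameRun (link : ℕ → Prop) (c c' : ℕ) : Prop :=
  ∀ y, min c c' ≤ y → y < max c c' → link y

theorem SameRun.symm {link : ℕ → Prop} {c c' : ℕ} (h : SameRun link c c') :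
    SameRun link c' c := by
  unfold SameRun at *
  rwa [min_comm, max_comm]

theorem SameRun.trans {link : ℕ → Prop} {c c' c'' : ℕ} (h : SameRun link c c')
    (h' : SameRun link c' c'') : SameRun link c c'' := by
  intro y h1 h2
  by_cases h3 : min c c' ≤ y ∧ y < max c c'
  · exact h y h3.1 h3.2
  · exact h' y (by omega) (by omega)

/-- Runs are intervals, and they are finite because nothing is glued from `B` on. -/
theorem exists_run_ends (link : ℕ → Prop) (B : ℕ) (hB : ∀ c, link c → c < B) (c : ℕ) :
    ∃ lo hi, lo ≤ c ∧ c ≤ hi ∧ ∀ x, SameRun link c x ↔ lo ≤ x ∧ x ≤ hi := by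
  classical
  have hlo : ∃ x, SameRun link c x := ⟨c, fun y h1 h2 => by omega⟩
  have hc : SameRun link c c := fun y h1 h2 => by omega
  have hbd : ∀ x, SameRun link c x → x ≤ c + B := by
    intro x hx
    by_contra hlt
    have := hB _ (hx (c + B) (by omega) (by omega))
    omega
  refine ⟨Nat.find hlo, Nat.findGreatest (SameRun link c) (c + B), Nat.find_min' hlo hc,
    Nat.le_findGreatest (by omega) hc, fun x => ⟨fun hx => ⟨Nat.find_min' hlo hx,
    Nat.le_findGreatest (hbd x hx) hx⟩, ?_⟩⟩
  rintro ⟨h1, h2⟩ y h3 h4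
  have hl := Nat.find_spec hlo
  have hg : SameRun link c (Nat.findGreatest (SameRun link c) (c + B)) :=
    Nat.findGreatest_spec (P := SameRun link c) (m := c) (by omega) hc
  rcases le_or_gt c y with h | h
  · have h5 : y < x := (lt_max_iff.1 h4).resolve_left (by omega)
    exact hg y ((min_le_left _ _).trans h) (lt_max_of_lt_right (by omega))
  · have h5 : x ≤ y := (min_le_iff.1 h3).resolve_left (by omega)
    exact hl y ((min_le_right _ _).trans (by omega)) (lt_max_of_lt_left h)

open Classical in
/-- The reversal of every run of `link`. -/
noncomputable def runReversal (link : ℕ → Prop) (c : ℕ) : ℕ :=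
  if h : ∃ B, ∀ c, link c → c < B then
    (exists_run_ends link h.choose h.choose_spec c).choose +
      (exists_run_ends link h.choose h.choose_spec c).choose_spec.choose - c
  else c

theorem runReversal_spec {link : ℕ → Prop} {B : ℕ} (hB : ∀ c, link c → c < B) (c : ℕ) :
    ∃ lo hi, runReversal link c = lo + hi - c ∧ lo ≤ c ∧ c ≤ hi ∧
      ∀ x, SameRun link c x ↔ lo ≤ x ∧ x ≤ hi := by
  have h : ∃ B, ∀ c, link c → c < B := ⟨B, hB⟩
  refine ⟨_, _, dif_pos h, ?_⟩
  exact (exists_run_ends link h.choose h.choose_spec c).choose_spec.choose_spec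

theorem runReversal_eq {link : ℕ → Prop} {B : ℕ} (hB : ∀ c, link c → c < B) {c lo hi : ℕ}
    (hc : lo ≤ c ∧ c ≤ hi) (h : ∀ x, SameRun link c x ↔ lo ≤ x ∧ x ≤ hi) :
    runReversal link c = lo + hi - c := by
  obtain ⟨lo', hi', h1, h2, h3, h4⟩ := runReversal_spec hB c
  have a1 := (h4 lo).1 ((h lo).2 ⟨le_rfl, by omega⟩)
  have a2 := (h4 hi).1 ((h hi).2 ⟨by omega, le_rfl⟩)
  have a3 := (h lo').1 ((h4 lo').2 ⟨le_rfl, by omega⟩)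
  have a4 := (h hi').1 ((h4 hi').2 ⟨by omega, le_rfl⟩)
  omega

theorem runReversal_involutive {link : ℕ → Prop} {B : ℕ} (hB : ∀ c, link c → c < B) (c : ℕ) :
    runReversal link (runReversal link c) = c := by
  obtain ⟨lo, hi, h1, h2, h3, h4⟩ := runReversal_spec hB c
  have hs : SameRun link c (runReversal link c) := (h4 _).2 (by omega)
  rw [runReversal_eq hB (c := runReversal link c) (lo := lo) (hi := hi) (by omega)]
  · omega
  · intro x
    rw [← h4 x]
    exact ⟨fun h => hs.trans h, fun h => hs.symm.trans h⟩

/-- Reflecting an interval sends neighbours to neighbours in the opposite order, and these are glued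
again because they lie in the same run. This lets a row condition be used at the reflected place. -/
theorem runReversal_of_link {link : ℕ → Prop} {B : ℕ} (hB : ∀ c, link c → c < B) {c : ℕ}
    (h : link c) : runReversal link c = runReversal link (c + 1) + 1 ∧
      link (runReversal link (c + 1)) := by
  obtain ⟨lo, hi, h1, h2, h3, h4⟩ := runReversal_spec hB c
  have hs : SameRun link c (c + 1) := fun y h1 h2 => by
    obtain rfl : y = c := by omega
    exact h
  have h5 := (h4 _).1 hs
  have h6 : runReversal link (c + 1) = lo + hi - (c + 1) := by
    refine runReversal_eq hB (by omega) fun x => ?_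
    rw [← h4 x]
    exact ⟨fun h => hs.trans h, fun h => hs.symm.trans h⟩
  refine ⟨by omega, ?_⟩
  have h7 : SameRun link lo hi := ((h4 lo).2 (by omega)).symm.trans ((h4 hi).2 (by omega))
  exact h7 _ (by omega) (by omega)

theorem runReversal_eq_self_or {link : ℕ → Prop} {B : ℕ} (hB : ∀ c, link c → c < B)
    {P : ℕ → Prop} (hP : ∀ c, link c → P c ∧ P (c + 1)) (c : ℕ) :
    runReversal link c = c ∨ (P c ∧ P (runReversal link c)) := by
  obtain ⟨lo, hi, h1, h2, h3, h4⟩ := runReversal_spec hB c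
  have h7 : SameRun link lo hi := ((h4 lo).2 (by omega)).symm.trans ((h4 hi).2 (by omega))
  have key : ∀ x, lo < hi → lo ≤ x → x ≤ hi → P x := by
    intro x h0 h5 h6
    rcases h6.lt_or_eq with h | rfl
    · exact (hP x (h7 x (by omega) (by omega))).1
    · have := (hP (x - 1) (h7 (x - 1) (by omega) (by omega))).2
      rwa [Nat.sub_add_cancel (by omega)] at this
  by_cases h : lo < hi
  · exact Or.inr ⟨key _ h h2 h3, key _ h (by omega) (by omega)⟩
  · left; omega

/-! ### Column tableaux -/

open Finset

/-- The number of elements of `A` below `m`. -/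
def below (A : Finset ℕ) (m : ℕ) : ℕ := Nat.count (· ∈ A) m

theorem below_succ (A : Finset ℕ) (m : ℕ) :
    below A (m + 1) = below A m + if m ∈ A then 1 else 0 :=
  Nat.count_succ _ _

theorem below_mono (A : Finset ℕ) : Monotone (below A) := Nat.count_monotone _

theorem below_eq_card_filter (A : Finset ℕ) (m : ℕ) :
    below A m = #{x ∈ A | x < m} := by
  unfold below
  rw [Nat.count_eq_card_filter_range]
  congr 1
  ext x
  simp [and_comm]

theorem below_of_subset {A : Finset ℕ} {N m : ℕ} (h : A ⊆ range N) (hm : N ≤ m) :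
    below A m = #A := by
  rw [below_eq_card_filter, filter_true_of_mem]
  intro x hx
  have := mem_range.1 (h hx)
  omega

theorem below_le_card (A : Finset ℕ) (m : ℕ) : below A m ≤ #A := by
  rw [below_eq_card_filter]
  exact card_filter_le _ _

/-- `A` is a semistandard filling, with entries below `N`, of the skew shape with `W` columns,
the `c`-th one consisting of `l c` cells whose first row is `a c`; the entries of the `c`-th column
form the set `A c`. -/
structure IsColTableau (N W : ℕ) (a : ℕ → ℤ) (l : ℕ → ℕ) (A : ℕ → Finset ℕ) : Prop where
  subset : ∀ c, A c ⊆ range N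
  eq_empty : ∀ c, W ≤ c → A c = ∅
  card_eq : ∀ c, c < W → #(A c) = l c
  row : ∀ c, c + 1 < W → ∀ m, a (c + 1) + (below (A (c + 1)) m : ℤ) ≤ a c + below (A c) m

theorem finite_isColTableau (N W : ℕ) (a : ℕ → ℤ) (l : ℕ → ℕ) :
    {A | IsColTableau N W a l A}.Finite := by
  refine Set.Finite.of_finite_image (f := fun A (c : Fin W) => A c)
    (Set.Finite.subset (Set.Finite.pi' fun _ : Fin W => (range N).powerset.finite_toSet) ?_) ?_
  · rintro _ ⟨A, hA, rfl⟩ c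
    exact mem_coe.2 (mem_powerset.2 (hA.subset c))
  · intro A hA B hB h
    funext c
    by_cases hc : c < W
    · exact congrFun h ⟨c, hc⟩
    · rw [hA.eq_empty c (by omega), hB.eq_empty c (by omega)]

/-- The finite set of column tableaux. -/
noncomputable def colTableaux (N W : ℕ) (a : ℕ → ℤ) (l : ℕ → ℕ) : Finset (ℕ → Finset ℕ) :=
  (finite_isColTableau N W a l).toFinset

@[simp]
theorem mem_colTableaux {N W : ℕ} {a : ℕ → ℤ} {l : ℕ → ℕ} {A : ℕ → Finset ℕ} :
    A ∈ colTableaux N W a l ↔ IsColTableau N W a l A := by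
  simp [colTableaux]

/-- The number of columns among `j, …, W - 1` that contain the letter `x`. -/
def weightFrom (W : ℕ) (A : ℕ → Finset ℕ) (j x : ℕ) : ℕ := #{c ∈ Ico j W | x ∈ A c}

/-- The alternating sum detecting the shifted weight `ν`. -/
def altSum (N : ℕ) (ν v : ℕ → ℕ) : ℤ :=
  ∑ w : Equiv.Perm (Fin N), (Equiv.Perm.sign w : ℤ) *
    if ∀ i : Fin N, (ν (w i) : ℤ) - (w i : ℕ) = v i - (i : ℕ) then 1 else 0

/-- Multiplying `w` by the transposition permutes the terms and flips every sign. -/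
theorem altSum_swap {N : ℕ} {ν v v' : ℕ → ℕ} {i : ℕ} (hi : i + 1 < N)
    (h : ∀ x < N, (v' x : ℤ) - x = v (Equiv.swap i (i + 1) x) - (Equiv.swap i (i + 1) x : ℕ)) :
    altSum N ν v' = - altSum N ν v := by
  unfold altSum
  set s : Equiv.Perm (Fin N) := Equiv.swap ⟨i, by omega⟩ ⟨i + 1, hi⟩ with hs
  have hval : ∀ x : Fin N, ((s x : Fin N) : ℕ) = Equiv.swap i (i + 1) (x : ℕ) := by
    intro x
    simp only [hs, Equiv.swap_apply_def, Fin.ext_iff]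
    split_ifs <;> rfl
  rw [← Equiv.sum_comp (Equiv.mulRight s), ← sum_neg_distrib]
  refine sum_congr rfl fun w _ => ?_
  have hsign : (Equiv.Perm.sign (w * s) : ℤ) = - Equiv.Perm.sign w := by
    rw [Equiv.Perm.sign_mul, hs, Equiv.Perm.sign_swap (by simp [Fin.ext_iff])]
    simp
  simp only [Equiv.coe_mulRight, Equiv.Perm.coe_mul, Function.comp_apply]
  rw [hsign, neg_mul]
  congr 2
  refine if_congr ?_ rfl rfl
  have hss : ∀ x, s (s x) = x := fun x => by simp [hs]
  constructor
  · intro hw x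
    have := hw (s x)
    rw [hss, h _ (s x).2, ← hval, hss] at this
    exact this
  · intro hw x
    rw [hw (s x), h _ x.2, hval]

/-- Both shifted sequences decrease strictly, so a permutation matching them is increasing, hence
trivial. -/
theorem perm_eq_one_of_shifted_eq {N : ℕ} {ν v : ℕ → ℕ} (hν : Antitone ν)
    (hv : ∀ i, i + 1 < N → v (i + 1) ≤ v i) {w : Equiv.Perm (Fin N)}
    (h : ∀ i : Fin N, (ν (w i) : ℤ) - (w i : ℕ) = v i - (i : ℕ)) : w = 1 := by
  have hv' : ∀ i j : ℕ, i ≤ j → j < N → v j ≤ v i := by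
    intro i j hij
    induction j, hij using Nat.le_induction with
    | base => simp
    | succ j _ ih => exact fun hj => (hv j hj).trans (ih (by omega))
  have hw : StrictMono w := by
    intro x y hxy
    by_contra hle
    have hxy' : (x : ℕ) < y := hxy
    have hle' : (w y : ℕ) ≤ w x := not_lt.1 hle
    have h1 := h x
    have h2 := h y
    have h3 := hv' x y hxy'.le y.2
    have h4 := hν hle'
    omega
  ext x
  have := (StrictMono.range_inj (f := w) (g := id) hw strictMono_id).1 (by simp)
  rw [this]; rfl

theorem altSum_nonneg {N : ℕ} {ν v : ℕ → ℕ} (hν : Antitone ν)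
    (hv : ∀ i, i + 1 < N → v (i + 1) ≤ v i) : 0 ≤ altSum N ν v := by
  refine sum_nonneg fun w _ => ?_
  split_ifs with h
  · simp [perm_eq_one_of_shifted_eq hν hv h]
  · simp

theorem exists_perm_of_altSum_ne_zero {N : ℕ} {ν v : ℕ → ℕ} (h : altSum N ν v ≠ 0) :
    ∃ w : Equiv.Perm (Fin N), ∀ i : Fin N, (ν (w i) : ℤ) - (w i : ℕ) = v i - (i : ℕ) := by
  obtain ⟨w, -, hw⟩ := exists_ne_zero_of_sum_ne_zero h
  refine ⟨w, ?_⟩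
  by_contra hcon
  rw [if_neg hcon, mul_zero] at hw
  exact hw rfl

theorem eq_of_altSum_ne_zero {N : ℕ} {ν v : ℕ → ℕ} (hν : Antitone ν)
    (hv : ∀ i, i + 1 < N → v (i + 1) ≤ v i) (h : altSum N ν v ≠ 0) {i : ℕ} (hi : i < N) :
    v i = ν i := by
  obtain ⟨w, hw⟩ := exists_perm_of_altSum_ne_zero h
  have := hw ⟨i, hi⟩
  rw [perm_eq_one_of_shifted_eq hν hv hw] at this
  simp at this
  omega

theorem shifted_injective {ν : ℕ → ℕ} (hν : Antitone ν) {x y : ℕ}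
    (h : (ν x : ℤ) - x = ν y - y) : x = y := by
  rcases le_total x y with h1 | h1
  · have := hν h1; omega
  · have := hν h1; omega

theorem altSum_self {N : ℕ} {ν : ℕ → ℕ} (hν : Antitone ν) : altSum N ν ν = 1 := by
  unfold altSum
  rw [sum_eq_single 1]
  · simp
  · intro w _ hw
    rw [if_neg, mul_zero]
    intro h
    exact hw (Equiv.ext fun x => Fin.ext (shifted_injective hν (h x)))
  · simp

/-- If the first `q` entries of `ν` bound those of `v` from above, then the alternating sum
vanishes unless these entries agree. -/
theorem eq_of_altSum_ne_zero_of_le {N q : ℕ} {ν v : ℕ → ℕ} (hq : q ≤ N)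
    (hv : ∀ i < q, ∀ j, i ≤ j → j < N → v j ≤ ν i) (h : altSum N ν v ≠ 0) {i : ℕ} (hi : i < q) :
    v i = ν i := by
  obtain ⟨w, hw⟩ := exists_perm_of_altSum_ne_zero h
  -- Let `j` be the preimage of `i`. It is at least `i` because smaller indices are fixed, and ν i -
  -- i = v j - j ≤ ν i - j forces j ≤ i.
  have key : ∀ i (hi : i < q), w ⟨i, by omega⟩ = ⟨i, by omega⟩ := by
    intro i
    induction i using Nat.strong_induction_on with
    | _ i ih =>
      intro hi
      set j := w.symm ⟨i, by omega⟩ with hj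
      have hwj : w j = ⟨i, by omega⟩ := by simp [hj]
      have hij : i ≤ j := by
        by_contra hlt
        have h1 := ih j (not_le.1 hlt) (by omega)
        rw [show (⟨(j : ℕ), by omega⟩ : Fin N) = j from rfl, hwj] at h1
        have := congrArg Fin.val h1
        simp at this
        omega
      have h1 := hw j
      rw [hwj] at h1
      have h2 := hv i hi j hij j.2
      simp only at h1
      have h3 : j = ⟨i, by omega⟩ := Fin.ext (by simp only; omega)
      rw [h3] at hwj
      exact hwj
  have h1 := hw ⟨i, by omega⟩
  rw [key i hi] at h1
  simp only at h1
  omega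

/-- Raising the first `p` entries of both arguments does not change the alternating sum. -/
theorem altSum_add_initial {N p : ℕ} {ν v ν' v' : ℕ → ℕ} (hν : Antitone ν)
    (hνv : ∀ i < p, v i = ν i) (hν' : ∀ i, ν' i = ν i + if i < p then 1 else 0)
    (hv' : ∀ i, v' i = v i + if i < p then 1 else 0) :
    altSum N ν' v' = altSum N ν v := by
  have hνa : Antitone ν' := by
    intro x y hxy
    have := hν hxy
    rw [hν', hν']
    split_ifs <;> omega
  -- A permutation contributing to either sum fixes all indices below `p`, so it preserves this
  -- initial segment and both sides of each equation are raised together.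
  have aux : ∀ (μ u : ℕ → ℕ) (w : Equiv.Perm (Fin N)), Antitone μ → (∀ i < p, u i = μ i) →
      (∀ i : Fin N, (μ (w i) : ℤ) - (w i : ℕ) = u i - (i : ℕ)) →
      ∀ i : Fin N, (w i : ℕ) < p ↔ (i : ℕ) < p := by
    intro μ u w hμ hu h
    have hfix : ∀ i : Fin N, (i : ℕ) < p → w i = i := by
      intro i hi
      have := h i
      rw [hu i hi] at this
      exact Fin.ext (shifted_injective hμ this)
    refine fun i => ⟨fun hi => ?_, fun hi => by rwa [hfix i hi]⟩
    have := w.injective (hfix (w i) hi)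
    rwa [this] at hi
  unfold altSum
  refine sum_congr rfl fun w _ => ?_
  congr 1
  refine if_congr ⟨fun h i => ?_, fun h i => ?_⟩ rfl rfl
  · have h1 := aux ν' v' w hνa (fun i hi => by rw [hν', hv', hνv i hi]) h i
    have h2 := h i
    rw [hν', hv'] at h2
    by_cases hi : (i : ℕ) < p
    · rw [if_pos hi, if_pos (h1.2 hi)] at h2
      push_cast at h2
      omega
    · rw [if_neg hi, if_neg (fun h => hi (h1.1 h))] at h2
      simpa using h2
  · have h1 := aux ν v w hν hνv h i
    have h2 := h i
    rw [hν', hv']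
    by_cases hi : (i : ℕ) < p
    · rw [if_pos hi, if_pos (h1.2 hi)]
      push_cast
      omega
    · rw [if_neg hi, if_neg (fun h => hi (h1.1 h))]
      simpa using h2

/-! ### Bender–Knuth involutions on the left part of a tableau -/

/-- The set `X` with `i` and `i + 1` exchanged. -/
def swapSet (i : ℕ) (X : Finset ℕ) : Finset ℕ := X.map (Equiv.swap i (i + 1)).toEmbedding

theorem mem_swapSet {i x : ℕ} {X : Finset ℕ} :
    x ∈ swapSet i X ↔ Equiv.swap i (i + 1) x ∈ X := by
  rw [swapSet, mem_map_equiv, Equiv.symm_swap]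

theorem left_mem_swapSet {i : ℕ} {X : Finset ℕ} : i ∈ swapSet i X ↔ i + 1 ∈ X := by
  rw [mem_swapSet, Equiv.swap_apply_left]

theorem right_mem_swapSet {i : ℕ} {X : Finset ℕ} : i + 1 ∈ swapSet i X ↔ i ∈ X := by
  rw [mem_swapSet, Equiv.swap_apply_right]

/-- Only the threshold `i + 1` separates the two exchanged letters. -/
theorem below_swapSet {i m : ℕ} (hm : m ≠ i + 1) (X : Finset ℕ) :
    below (swapSet i X) m = below X m := by
  have : {x ∈ swapSet i X | x < m} = swapSet i {x ∈ X | x < m} := by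
    ext x
    simp only [mem_filter, mem_swapSet]
    refine and_congr_right fun _ => ?_
    rw [Equiv.swap_apply_def]
    split_ifs <;> omega
  rw [below_eq_card_filter, below_eq_card_filter, this, swapSet, card_map]

/-- Exactly one of `i`, `i + 1` lies in `X`. -/
def IsFree (i : ℕ) (X : Finset ℕ) : Prop := i ∈ X ↔ i + 1 ∉ X

theorem isFree_swapSet {i : ℕ} {X : Finset ℕ} : IsFree i (swapSet i X) ↔ IsFree i X := by
  unfold IsFree
  rw [left_mem_swapSet, right_mem_swapSet]
  tauto

/-- The columns `c` and `c + 1`, both left of `j`, have an unpaired entry `i` or `i + 1` each, in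
the same row. -/
def bkLink (a : ℕ → ℤ) (i j : ℕ) (A : ℕ → Finset ℕ) (c : ℕ) : Prop :=
  c + 1 < j ∧ IsFree i (A c) ∧ IsFree i (A (c + 1)) ∧
    a (c + 1) + (below (A (c + 1)) i : ℤ) = a c + below (A c) i

open Classical in
/-- The Bender–Knuth involution exchanging the numbers of `i` and `i + 1` in the columns left
of `j`. -/
noncomputable def benderKnuth (a : ℕ → ℤ) (i j : ℕ) (A : ℕ → Finset ℕ) (c : ℕ) : Finset ℕ :=
  if c < j ∧ IsFree i (A c) ∧ (i ∈ A (runReversal (bkLink a i j A) c) ↔ i ∈ A c) then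
    swapSet i (A c)
  else A c

section BenderKnuth

variable (a : ℕ → ℤ) (i j : ℕ) (A : ℕ → Finset ℕ)

theorem bkLink_lt (c : ℕ) (h : bkLink a i j A c) : c < j := by
  have := h.1
  omega

theorem benderKnuth_eq_or (c : ℕ) :
    benderKnuth a i j A c = swapSet i (A c) ∨ benderKnuth a i j A c = A c := by
  unfold benderKnuth
  split_ifs <;> simp

theorem benderKnuth_of_le {c : ℕ} (h : j ≤ c) : benderKnuth a i j A c = A c :=
  if_neg fun h' => by omega

theorem mem_benderKnuth_of_ne {x : ℕ} (h1 : x ≠ i) (h2 : x ≠ i + 1) (c : ℕ) :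
    x ∈ benderKnuth a i j A c ↔ x ∈ A c := by
  rcases benderKnuth_eq_or a i j A c with h | h
  · rw [h, mem_swapSet, Equiv.swap_apply_of_ne_of_ne h1 h2]
  · rw [h]

theorem below_benderKnuth {m : ℕ} (hm : m ≠ i + 1) (c : ℕ) :
    below (benderKnuth a i j A c) m = below (A c) m := by
  rcases benderKnuth_eq_or a i j A c with h | h
  · rw [h, below_swapSet hm]
  · rw [h]

theorem isFree_benderKnuth (c : ℕ) : IsFree i (benderKnuth a i j A c) ↔ IsFree i (A c) := by
  rcases benderKnuth_eq_or a i j A c with h | h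
  · rw [h, isFree_swapSet]
  · rw [h]

/-- Freeness and the counts below `i` do not see the exchange of `i` and `i + 1`, so the runs stay
the same; this is what makes the map an involution. -/
theorem bkLink_benderKnuth : bkLink a i j (benderKnuth a i j A) = bkLink a i j A := by
  funext c
  unfold bkLink
  rw [isFree_benderKnuth, isFree_benderKnuth, below_benderKnuth _ _ _ _ (by omega),
    below_benderKnuth _ _ _ _ (by omega)]

theorem runReversal_bkLink (c : ℕ) :
    runReversal (bkLink a i j A) c = c ∨ ((c < j ∧ IsFree i (A c)) ∧
      (runReversal (bkLink a i j A) c < j ∧ IsFree i (A (runReversal (bkLink a i j A) c)))) :=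
  runReversal_eq_self_or (bkLink_lt a i j A) (P := fun c => c < j ∧ IsFree i (A c))
    (fun _ h => ⟨⟨by have := h.1; omega, h.2.1⟩, h.1, h.2.2.1⟩) c

theorem runReversal_bkLink_lt {c : ℕ} (hc : c < j) : runReversal (bkLink a i j A) c < j := by
  rcases runReversal_bkLink a i j A c with h | h
  · rwa [h]
  · exact h.2.1

theorem isFree_runReversal {c : ℕ} (hc : IsFree i (A c)) :
    IsFree i (A (runReversal (bkLink a i j A) c)) := by
  rcases runReversal_bkLink a i j A c with h | h
  · rwa [h]
  · exact h.2.2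

/-- In a tableau the free entries of a run read i…i (i+1)…(i+1). Reversing the run and exchanging
the letters gives a word of the same kind, so the new column `c` carries the exchanged letter of the
reflected column. Columns with both letters or neither are fixed by the reflection. -/
theorem left_mem_benderKnuth {c : ℕ} (hc : c < j) :
    i ∈ benderKnuth a i j A c ↔ i + 1 ∈ A (runReversal (bkLink a i j A) c) := by
  by_cases hf : IsFree i (A c)
  · have hf' := isFree_runReversal a i j A hf
    unfold benderKnuth
    unfold IsFree at hf hf'
    split_ifs with h
    · rw [left_mem_swapSet]; tauto
    · have : ¬ (i ∈ A (runReversal (bkLink a i j A) c) ↔ i ∈ A c) := fun h' => h ⟨hc, hf, h'⟩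
      tauto
  · have hs : runReversal (bkLink a i j A) c = c :=
      (runReversal_bkLink a i j A c).resolve_right fun h => hf h.1.2
    rw [hs, benderKnuth, if_neg fun h => hf h.2.1]
    unfold IsFree at hf
    tauto

theorem right_mem_benderKnuth {c : ℕ} (hc : c < j) :
    i + 1 ∈ benderKnuth a i j A c ↔ i ∈ A (runReversal (bkLink a i j A) c) := by
  by_cases hf : IsFree i (A c)
  · have h1 := (isFree_benderKnuth a i j A c).2 hf
    have h2 := left_mem_benderKnuth a i j A hc
    have h3 := isFree_runReversal a i j A hf
    unfold IsFree at h1 h3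
    tauto
  · have hs : runReversal (bkLink a i j A) c = c :=
      (runReversal_bkLink a i j A c).resolve_right fun h => hf h.1.2
    rw [hs, benderKnuth, if_neg fun h => hf h.2.1]
    unfold IsFree at hf
    tauto

theorem benderKnuth_benderKnuth : benderKnuth a i j (benderKnuth a i j A) = A := by
  funext c
  rcases lt_or_ge c j with hc | hc
  swap
  · rw [benderKnuth_of_le _ _ _ _ hc, benderKnuth_of_le _ _ _ _ hc]
  have hσ := runReversal_involutive (bkLink_lt a i j A) c
  have hσ' := runReversal_bkLink_lt a i j A hc
  ext x
  by_cases h1 : x = i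
  · subst h1
    rw [left_mem_benderKnuth _ _ _ _ hc, bkLink_benderKnuth, right_mem_benderKnuth _ _ _ _ hσ', hσ]
  by_cases h2 : x = i + 1
  · subst h2
    rw [right_mem_benderKnuth _ _ _ _ hc, bkLink_benderKnuth, left_mem_benderKnuth _ _ _ _ hσ', hσ]
  rw [mem_benderKnuth_of_ne _ _ _ _ h1 h2, mem_benderKnuth_of_ne _ _ _ _ h1 h2]

variable {a i j A}

/-- Only the row conditions at the threshold `i + 1` can change. At the border between modified and
unmodified columns, `i ∉ A j` excludes a violation. -/
theorem IsColTableau.benderKnuth {N W : ℕ} {l : ℕ → ℕ} (hA : IsColTableau N W a l A)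
    (hi : i + 1 < N) (hj : j < W) (hmem : i ∉ A j) :
    IsColTableau N W a l (benderKnuth a i j A) where
  subset c := by
    rcases benderKnuth_eq_or a i j A c with h | h
    · rw [h]
      intro x hx
      have := mem_range.1 (hA.subset c (mem_swapSet.1 hx))
      rw [Equiv.swap_apply_def] at this
      rw [mem_range]
      split_ifs at this <;> omega
    · rw [h]
      exact hA.subset c
  eq_empty c hc := by rw [benderKnuth_of_le _ _ _ _ (by omega), hA.eq_empty c hc]
  card_eq c hc := by
    rw [← hA.card_eq c hc]
    rcases benderKnuth_eq_or a i j A c with h | h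
    · rw [h, swapSet, card_map]
    · rw [h]
  row c hc m := by
    by_cases hm : m = i + 1
    swap
    · rw [below_benderKnuth a i j A hm, below_benderKnuth a i j A hm]
      exact hA.row c hc m
    subst hm
    rw [below_succ, below_succ, below_benderKnuth a i j A (by omega),
      below_benderKnuth a i j A (by omega)]
    have r0 := hA.row c hc i
    have r1 := hA.row c hc (i + 1)
    have r2 := hA.row c hc (i + 1 + 1)
    rw [below_succ _ (i + 1), below_succ _ (i + 1), below_succ, below_succ] at r2
    rw [below_succ, below_succ] at r1
    push_cast at r1 r2 ⊢
    -- If the condition at `i` has slack, a single further letter cannot break the one at `i + 1`.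
    by_cases htight : a (c + 1) + (below (A (c + 1)) i : ℤ) = a c + below (A c) i
    swap
    · split_ifs <;> omega
    by_cases hl : i ∈ _root_.benderKnuth a i j A (c + 1)
    swap
    · rw [if_neg hl]
      split_ifs <;> omega
    have key : i ∈ _root_.benderKnuth a i j A c := by
      rcases lt_trichotomy (c + 1) j with hcj | rfl | hcj
      · rw [left_mem_benderKnuth _ _ _ _ hcj] at hl
        rw [left_mem_benderKnuth _ _ _ _ (by omega)]
        -- Linked columns are reflected to linked columns `e`, `e + 1`, where the row condition of
        -- `A` carries the letter `i + 1` from `e` to `e + 1`.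
        by_cases hf : bkLink a i j A c
        · obtain ⟨h1, h2⟩ := runReversal_of_link (bkLink_lt a i j A) hf
          rw [h1]
          set e := runReversal (bkLink a i j A) (c + 1)
          obtain ⟨h3, h4, h5, h6⟩ := h2
          have r1 := hA.row e (by omega) (i + 1)
          rw [below_succ, below_succ] at r1
          unfold IsFree at h4 h5
          by_contra hcon
          rw [if_pos (by tauto), if_neg (by tauto)] at r1
          push_cast at r1
          omega
        · have hnf : ¬ IsFree i (A c) ∨ ¬ IsFree i (A (c + 1)) := by
            by_contra hcon
            push Not at hcon
            exact hf ⟨hcj, hcon.1, hcon.2, htight⟩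
          have hfix : ¬ IsFree i (A (c + 1)) → runReversal (bkLink a i j A) (c + 1) = c + 1 :=
            fun h => (runReversal_bkLink a i j A (c + 1)).resolve_right fun h' => h h'.1.2
          have hfix' : ¬ IsFree i (A c) → runReversal (bkLink a i j A) c = c :=
            fun h => (runReversal_bkLink a i j A c).resolve_right fun h' => h h'.1.2
          -- One of the two columns is not free and hence fixed by the reversal. The row condition
          -- at `i + 2` leaves only the case that column `c` holds both letters.
          have hboth : i ∈ A c ∧ i + 1 ∈ A c := by
            by_cases hf1 : IsFree i (A (c + 1))
            · have hf0 := hnf.resolve_right (not_not.2 hf1)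
              unfold IsFree at hf1 hf0
              by_contra hcon
              rw [if_neg (c := i ∈ A c) (by tauto), if_neg (c := i + 1 ∈ A c) (by tauto)] at r2
              split_ifs at r2 <;> first | omega | tauto
            · rw [hfix hf1] at hl
              unfold IsFree at hf1
              rw [if_pos (c := i ∈ A (c + 1)) (by tauto), if_pos (c := i + 1 ∈ A (c + 1)) hl] at r2
              split_ifs at r2 <;> first | omega | tauto
          rw [hfix' (by unfold IsFree; tauto)]
          exact hboth.2
      · rw [benderKnuth_of_le _ _ _ _ le_rfl] at hl
        exact absurd hl hmem
      · rw [benderKnuth_of_le _ _ _ _ (by omega)] at hl ⊢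
        by_contra hcon
        rw [if_pos hl, if_neg hcon] at r1
        omega
    rw [if_pos key]
    split_ifs
    omega

theorem card_filter_left_benderKnuth :
    #{c ∈ range j | i ∈ benderKnuth a i j A c} = #{c ∈ range j | i + 1 ∈ A c} := by
  refine card_bij (fun c _ => runReversal (bkLink a i j A) c) ?_ ?_ ?_
  · intro c hc
    rw [mem_filter, mem_range] at hc ⊢
    exact ⟨runReversal_bkLink_lt _ _ _ _ hc.1, (left_mem_benderKnuth _ _ _ _ hc.1).1 hc.2⟩
  · intro c _ c' _ h
    rw [← runReversal_involutive (bkLink_lt a i j A) c, h,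
      runReversal_involutive (bkLink_lt a i j A)]
  · intro c hc
    rw [mem_filter, mem_range] at hc
    have h := runReversal_bkLink_lt a i j A hc.1
    refine ⟨runReversal (bkLink a i j A) c, ?_, runReversal_involutive (bkLink_lt a i j A) c⟩
    rw [mem_filter, mem_range, left_mem_benderKnuth _ _ _ _ h,
      runReversal_involutive (bkLink_lt a i j A)]
    exact ⟨h, hc.2⟩

theorem card_filter_right_benderKnuth :
    #{c ∈ range j | i + 1 ∈ benderKnuth a i j A c} = #{c ∈ range j | i ∈ A c} := by
  have h := card_filter_left_benderKnuth (a := a) (i := i) (j := j) (A := benderKnuth a i j A)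
  rw [benderKnuth_benderKnuth] at h
  exact h.symm

theorem weightFrom_zero_eq {W : ℕ} (hj : j ≤ W) (A : ℕ → Finset ℕ) (x : ℕ) :
    weightFrom W A 0 x = #{c ∈ range j | x ∈ A c} + weightFrom W A j x := by
  unfold weightFrom
  rw [← card_union_of_disjoint]
  · congr 1
    ext c
    simp only [mem_filter, mem_union, mem_Ico, mem_range]
    constructor
    · rintro ⟨h, h'⟩
      by_cases hc : c < j
      · exact Or.inl ⟨hc, h'⟩
      · exact Or.inr ⟨⟨by omega, h.2⟩, h'⟩
    · rintro (⟨h, h'⟩ | ⟨h, h'⟩)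
      · exact ⟨by omega, h'⟩
      · exact ⟨by omega, h'⟩
  · rw [disjoint_left]
    intro c hc hc'
    simp only [mem_filter, mem_Ico, mem_range] at hc hc'
    omega

theorem weightFrom_benderKnuth {W j' : ℕ} (h : j ≤ j') (x : ℕ) :
    weightFrom W (benderKnuth a i j A) j' x = weightFrom W A j' x := by
  unfold weightFrom
  congr 1
  refine filter_congr fun c hc => ?_
  rw [mem_Ico] at hc
  rw [benderKnuth_of_le _ _ _ _ (by omega)]

/-- Left of `j` the numbers of `i` and `i + 1` are exchanged. From `j` on there is one more `i + 1`
than `i`, which is precisely the difference of the shifts, so the shifted total weight is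
transposed. -/
theorem weightFrom_zero_benderKnuth {W : ℕ} (hj : j ≤ W)
    (h : weightFrom W A j (i + 1) = weightFrom W A j i + 1) (x : ℕ) :
    (weightFrom W (benderKnuth a i j A) 0 x : ℤ) - x =
      weightFrom W A 0 (Equiv.swap i (i + 1) x) - (Equiv.swap i (i + 1) x : ℕ) := by
  rw [weightFrom_zero_eq hj, weightFrom_zero_eq hj, weightFrom_benderKnuth le_rfl]
  by_cases h1 : x = i
  · subst h1
    rw [Equiv.swap_apply_left, card_filter_left_benderKnuth, h]
    push_cast; ring
  by_cases h2 : x = i + 1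
  · subst h2
    rw [Equiv.swap_apply_right, card_filter_right_benderKnuth, h]
    push_cast; ring
  rw [Equiv.swap_apply_of_ne_of_ne h1 h2]
  simp only [mem_benderKnuth_of_ne _ _ _ _ h1 h2]

end BenderKnuth

/-! ### The alternating sum over column tableaux -/

/-- The reading word of `A`, by columns from right to left, fails the lattice condition for `i` at
the columns from `j` on. -/
def FailsAt (N W : ℕ) (A : ℕ → Finset ℕ) (j i : ℕ) : Prop :=
  i + 1 < N ∧ weightFrom W A j i < weightFrom W A j (i + 1)

/-- Littlewood–Richardson tableaux. -/
def IsLattice (N W : ℕ) (A : ℕ → Finset ℕ) : Prop := ∀ j i, ¬ FailsAt N W A j i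

theorem weightFrom_of_le {W j : ℕ} (h : W ≤ j) (A : ℕ → Finset ℕ) (x : ℕ) :
    weightFrom W A j x = 0 := by
  rw [weightFrom, Ico_eq_empty_of_le h]
  simp

theorem weightFrom_eq_add {W j : ℕ} (h : j < W) (A : ℕ → Finset ℕ) (x : ℕ) :
    weightFrom W A j x = weightFrom W A (j + 1) x + if x ∈ A j then 1 else 0 := by
  unfold weightFrom
  rw [← Finset.insert_Ico_add_one_left_eq_Ico h, filter_insert]
  split_ifs with hx
  · rw [card_insert_of_notMem (by simp)]
  · rfl

/-! ### The sign-reversing involution at the last failure of the lattice condition -/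

section Failure

open Classical

/-- The last column at which the lattice condition fails. -/
noncomputable def failCol (N W : ℕ) (A : ℕ → Finset ℕ) : ℕ :=
  Nat.findGreatest (fun j => ∃ i, FailsAt N W A j i) W

/-- The first letter for which the lattice condition fails at the last possible column. -/
noncomputable def failLetter (N W : ℕ) (A : ℕ → Finset ℕ) : ℕ :=
  sInf {i | FailsAt N W A (failCol N W A) i}

theorem FailsAt.lt {N W : ℕ} {A : ℕ → Finset ℕ} {j i : ℕ} (h : FailsAt N W A j i) : j < W := by
  by_contra hj
  have := h.2
  rw [weightFrom_of_le (by omega), weightFrom_of_le (by omega)] at this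
  omega

theorem failsAt_failCol {N W : ℕ} {A : ℕ → Finset ℕ} (h : ¬ IsLattice N W A) :
    FailsAt N W A (failCol N W A) (failLetter N W A) := by
  unfold IsLattice at h
  push Not at h
  obtain ⟨j, hj⟩ := h
  have h1 : ∃ i, FailsAt N W A (failCol N W A) i :=
    Nat.findGreatest_spec (P := fun j => ∃ i, FailsAt N W A j i) (m := j) hj.choose_spec.lt.le hj
  exact Nat.sInf_mem h1

theorem not_failsAt_of_failCol_lt {N W : ℕ} {A : ℕ → Finset ℕ} {j : ℕ} (h : failCol N W A < j)
    (i : ℕ) : ¬ FailsAt N W A j i := by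
  intro hf
  exact Nat.findGreatest_is_greatest (P := fun j => ∃ i, FailsAt N W A j i) h hf.lt.le ⟨i, hf⟩

/-- The next column does not fail, so this column raises the excess of `i + 1` over `i` from at most
0 to a positive value. A column holds a letter at most once, so it contains `i + 1` but not `i`, and
the excess is exactly 1. -/
theorem failure_spec {N W : ℕ} {A : ℕ → Finset ℕ} (h : ¬ IsLattice N W A) :
    failLetter N W A ∉ A (failCol N W A) ∧
      weightFrom W A (failCol N W A) (failLetter N W A + 1) =
        weightFrom W A (failCol N W A) (failLetter N W A) + 1 := by
  have h1 := failsAt_failCol h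
  have h2 := not_failsAt_of_failCol_lt (N := N) (W := W) (A := A) (Nat.lt_succ_self _)
    (failLetter N W A)
  have h3 := h1.2
  have h4 : weightFrom W A (failCol N W A + 1) (failLetter N W A + 1) ≤
      weightFrom W A (failCol N W A + 1) (failLetter N W A) := by
    by_contra hcon
    exact h2 ⟨h1.1, not_le.1 hcon⟩
  rw [weightFrom_eq_add h1.lt, weightFrom_eq_add h1.lt] at h3 ⊢
  split_ifs at h3 ⊢ with h5 h6 <;> first | omega | exact ⟨by tauto, by omega⟩

/-- The sign-reversing involution on the tableaux that fail the lattice condition. -/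
noncomputable def signFlip (N W : ℕ) (a : ℕ → ℤ) (A : ℕ → Finset ℕ) : ℕ → Finset ℕ :=
  benderKnuth a (failLetter N W A) (failCol N W A) A

theorem failsAt_signFlip {N W : ℕ} {a : ℕ → ℤ} {A : ℕ → Finset ℕ} {j : ℕ}
    (h : failCol N W A ≤ j) (i : ℕ) :
    FailsAt N W (signFlip N W a A) j i ↔ FailsAt N W A j i := by
  unfold FailsAt signFlip
  rw [weightFrom_benderKnuth h, weightFrom_benderKnuth h]

/-- The columns from the failing one on are untouched, and they already witness the last failure. -/
theorem failCol_signFlip {N W : ℕ} {a : ℕ → ℤ} {A : ℕ → Finset ℕ} (h : ¬ IsLattice N W A) :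
    failCol N W (signFlip N W a A) = failCol N W A := by
  have h1 := failsAt_failCol h
  refine (Nat.findGreatest_eq_iff).2 ⟨h1.lt.le, fun _ => ⟨failLetter N W A, ?_⟩, ?_⟩
  · exact (failsAt_signFlip le_rfl _).2 h1
  · rintro j hj - ⟨i, hi⟩
    exact not_failsAt_of_failCol_lt hj i ((failsAt_signFlip hj.le i).1 hi)

theorem failLetter_signFlip {N W : ℕ} {a : ℕ → ℤ} {A : ℕ → Finset ℕ} (h : ¬ IsLattice N W A) :
    failLetter N W (signFlip N W a A) = failLetter N W A := by
  unfold failLetter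
  rw [failCol_signFlip h]
  simp only [failsAt_signFlip le_rfl]

/-- Only Littlewood–Richardson tableaux contribute to the alternating sum. -/
theorem sum_altSum_eq_sum_isLattice (N W : ℕ) (a : ℕ → ℤ) (l ν : ℕ → ℕ) :
    ∑ A ∈ colTableaux N W a l, altSum N ν (weightFrom W A 0) =
      ∑ A ∈ colTableaux N W a l with IsLattice N W A, altSum N ν (weightFrom W A 0) := by
  rw [← sum_filter_add_sum_filter_not (colTableaux N W a l) (IsLattice N W), add_eq_left]
  have key : ∀ A ∈ {A ∈ colTableaux N W a l | ¬ IsLattice N W A},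
      altSum N ν (weightFrom W (signFlip N W a A) 0) = - altSum N ν (weightFrom W A 0) := by
    intro A hA
    rw [mem_filter] at hA
    have h1 := failsAt_failCol hA.2
    exact altSum_swap h1.1 fun x _ =>
      weightFrom_zero_benderKnuth h1.lt.le (failure_spec hA.2).2 x
  refine sum_involution (fun A _ => signFlip N W a A) ?_ ?_ ?_ ?_
  · intro A hA
    rw [key A hA, add_neg_cancel]
  · intro A hA hne heq
    have := key A hA
    rw [heq] at this
    omega
  · intro A hA
    rw [mem_filter, mem_colTableaux] at hA ⊢
    have h1 := failsAt_failCol hA.2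
    exact ⟨hA.1.benderKnuth h1.1 h1.lt (failure_spec hA.2).1,
      fun h => h _ _ ((failsAt_signFlip le_rfl _).2 h1)⟩
  · intro A hA
    rw [mem_filter] at hA
    change benderKnuth a (failLetter N W (signFlip N W a A)) (failCol N W (signFlip N W a A)) _ = A
    rw [failLetter_signFlip hA.2, failCol_signFlip hA.2]
    exact benderKnuth_benderKnuth _ _ _ _

end Failure

theorem IsLattice.weightFrom_succ_le {N W : ℕ} {A : ℕ → Finset ℕ} (h : IsLattice N W A)
    (j : ℕ) {i : ℕ} (hi : i + 1 < N) : weightFrom W A j (i + 1) ≤ weightFrom W A j i := by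
  by_contra hcon
  exact h j i ⟨hi, not_le.1 hcon⟩

theorem sum_altSum_nonneg (N W : ℕ) (a : ℕ → ℤ) (l : ℕ → ℕ) {ν : ℕ → ℕ} (hν : Antitone ν) :
    0 ≤ ∑ A ∈ colTableaux N W a l, altSum N ν (weightFrom W A 0) := by
  classical
  rw [sum_altSum_eq_sum_isLattice]
  refine sum_nonneg fun A hA => altSum_nonneg hν fun i hi => ?_
  exact (mem_filter.1 hA).2.weightFrom_succ_le 0 hi

/-! ### Littlewood–Richardson tableaux -/

section Lattice

variable {N W : ℕ} {a : ℕ → ℤ} {l : ℕ → ℕ} {A : ℕ → Finset ℕ}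

theorem IsColTableau.row_le (hA : IsColTableau N W a l A) {c c' : ℕ} (h : c ≤ c') (hc' : c' < W)
    (m : ℕ) : a c' + (below (A c') m : ℤ) ≤ a c + below (A c) m := by
  induction c', h using Nat.le_induction with
  | base => rfl
  | succ c' _ ih => exact (hA.row c' hc' m).trans (ih (by omega))

/-- In a Littlewood–Richardson tableau each letter is at most the index of its row. -/
theorem IsLattice.le_row (hl : IsLattice N W A) (hA : IsColTableau N W a l A) {x c : ℕ}
    (hc : c < W) (hx : x ∈ A c) : a (W - 1) + (x : ℤ) ≤ a c + below (A c) x := by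
  induction x generalizing c with
  | zero =>
    have := hA.row_le (c := c) (c' := W - 1) (by omega) (by omega) 0
    simpa [below] using this
  | succ x ih =>
    have hxN := mem_range.1 (hA.subset c hx)
    have h1 : 0 < weightFrom W A c (x + 1) :=
      card_pos.2 ⟨c, mem_filter.2 ⟨mem_Ico.2 ⟨le_rfl, hc⟩, hx⟩⟩
    have h2 : 0 < weightFrom W A c x := h1.trans_le (hl.weightFrom_succ_le c hxN)
    obtain ⟨c', hc'⟩ := card_pos.1 h2
    rw [mem_filter, mem_Ico] at hc'
    have h3 := ih hc'.1.2 hc'.2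
    -- By the lattice condition `x` occurs in a column `c'` weakly to the right, and this row
    -- condition puts `x + 1` in column `c` strictly below that occurrence.
    have h4 := hA.row_le hc'.1.1 hc'.1.2 (x + 1)
    rw [below_succ (A c'), if_pos hc'.2] at h4
    push_cast at h4 ⊢
    omega

/-- A letter `x` lies at least `x` rows below the top of the last column, by `IsLattice.le_row`, and
every cell lies above the bottom end of column 0. -/
theorem IsLattice.lt_rows (hl : IsLattice N W A) (hA : IsColTableau N W a l A) {x c : ℕ}
    (hc : c < W) (hx : x ∈ A c) : a (W - 1) + (x : ℤ) < a 0 + l 0 := by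
  have h1 := hl.le_row hA hc hx
  have h2 := hA.row_le (Nat.zero_le c) hc (x + 1)
  rw [below_succ (A c), if_pos hx] at h2
  have h3 := below_le_card (A 0) (x + 1)
  rw [hA.card_eq 0 (by omega)] at h3
  push_cast at h2
  omega

/-- The alternating sum vanishes if `ν` has more parts than the shape has rows. -/
theorem sum_altSum_eq_zero (N W : ℕ) (a : ℕ → ℤ) (l : ℕ → ℕ) {ν : ℕ → ℕ} (hν : Antitone ν)
    {x : ℕ} (hx : x < N) (hνx : 0 < ν x) (h : a 0 + l 0 ≤ a (W - 1) + x) :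
    ∑ A ∈ colTableaux N W a l, altSum N ν (weightFrom W A 0) = 0 := by
  classical
  rw [sum_altSum_eq_sum_isLattice]
  refine sum_eq_zero fun A hA => ?_
  rw [mem_filter, mem_colTableaux] at hA
  by_contra hne
  have h1 := eq_of_altSum_ne_zero hν (fun i hi => hA.2.weightFrom_succ_le 0 hi) hne hx
  rw [← h1] at hνx
  obtain ⟨c, hc⟩ := card_pos.1 hνx
  rw [mem_filter, mem_Ico] at hc
  have := hA.2.lt_rows hA.1 hc.1.2 hc.2
  omega

theorem one_le_sum_altSum {N W : ℕ} {a : ℕ → ℤ} {l : ℕ → ℕ} {ν : ℕ → ℕ} (hν : Antitone ν)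
    {A : ℕ → Finset ℕ} (hA : IsColTableau N W a l A) (hl : IsLattice N W A)
    (h : ν = weightFrom W A 0) :
    1 ≤ ∑ A ∈ colTableaux N W a l, altSum N ν (weightFrom W A 0) := by
  classical
  rw [sum_altSum_eq_sum_isLattice]
  calc (1 : ℤ) = altSum N ν (weightFrom W A 0) := by rw [← h, altSum_self hν]
    _ ≤ _ := single_le_sum (f := fun A => altSum N ν (weightFrom W A 0)) (fun B hB => ?_)
        (mem_filter.2 ⟨mem_colTableaux.2 hA, hl⟩)
  exact altSum_nonneg hν fun i hi => (mem_filter.1 hB).2.weightFrom_succ_le 0 hi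

theorem mem_range_union_Ico {p q r x : ℕ} : x ∈ range p ∪ Ico q r ↔ x < p ∨ q ≤ x ∧ x < r := by
  simp

theorem below_range_union_Ico {p q r : ℕ} (h1 : p ≤ q) (h2 : q ≤ r) (m : ℕ) :
    below (range p ∪ Ico q r) m = min m p + (min m r - q) := by
  induction m with
  | zero => simp [below]
  | succ m ih =>
    rw [below_succ, ih]
    simp only [mem_range_union_Ico]
    split_ifs <;> omega

/-- A skew shape in which consecutive columns touch has a Littlewood–Richardson tableau that uses
as many letters as there are rows. -/
theorem exists_isLattice (hW : 0 < W) (ha : ∀ c, c + 1 < W → a (c + 1) ≤ a c)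
    (hb : ∀ c, c + 1 < W → a (c + 1) + l (c + 1) ≤ a c + l c)
    (hab : ∀ c, c + 1 < W → a c ≤ a (c + 1) + l (c + 1)) (hN : a 0 + l 0 ≤ a (W - 1) + N) :
    ∃ A, IsColTableau N W a l A ∧ IsLattice N W A ∧
      (∀ x : ℕ, a (W - 1) + x < a 0 + l 0 → 0 < weightFrom W A 0 x) ∧
      ∀ q : ℕ, (∀ c, c + 1 < W → a c + q ≤ a (c + 1) + l (c + 1)) → q ≤ l (W - 1) →
        ∀ x < q, weightFrom W A 0 x = W := by
  -- Rows are numbered from the top row of the last column.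
  set e : ℕ → ℕ := fun c => (a c - a (W - 1)).toNat with he
  have hz : ∀ c < W, a (W - 1) ≤ a c := by
    intro c hc
    have : ∀ c', c ≤ c' → c' < W → a c' ≤ a c := by
      intro c' h
      induction c', h using Nat.le_induction with
      | base => exact fun _ => le_rfl
      | succ c' _ ih => exact fun h => (ha c' h).trans (ih (by omega))
    exact this _ (by omega) (by omega)
  have hae : ∀ c < W, a c = a (W - 1) + e c := by
    intro c hc
    have := hz c hc
    simp only [he]
    omega
  have hlast : e (W - 1) = 0 := by simp [he]
  -- The first row below each column. The value 0 beyond the last column makes the filling below put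
  -- row numbers into the last column.
  set B : ℕ → ℕ := fun c => if c < W then e c + l c else 0 with hB
  have hB1 : ∀ c < W, B c = e c + l c := fun c hc => by simp [hB, hc]
  have hB0 : ∀ c, W ≤ c → B c = 0 := fun c hc => by simp [hB, not_lt.2 hc]
  have f1 : ∀ c < W, B (c + 1) ≤ B c := by
    intro c hc
    by_cases h : c + 1 < W
    · have := hb c h
      rw [hae c hc, hae _ h] at this
      rw [hB1 c hc, hB1 _ h]
      omega
    · rw [hB0 (c + 1) (by omega)]; omega
  have f2 : ∀ c < W, e c ≤ B (c + 1) := by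
    intro c hc
    by_cases h : c + 1 < W
    · have := hab c h
      rw [hae c hc, hae _ h] at this
      rw [hB1 _ h]
      omega
    · obtain rfl : c = W - 1 := by omega
      omega
  have f3 : ∀ c, c + 1 < W → e (c + 1) ≤ e c := by
    intro c h
    have := ha c h
    rw [hae c (by omega), hae _ h] at this
    omega
  have f4 : ∀ c, B c ≤ N := by
    intro c
    induction c with
    | zero =>
      rw [hae 0 hW] at hN
      rw [hB1 0 hW]
      omega
    | succ c ih =>
      by_cases h : c < W
      · exact (f1 c h).trans ih
      · rw [hB0 (c + 1) (by omega)]; omega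
  -- In column `c` the rows shared with column `c + 1` receive 0, 1, 2, …, and every cell below them
  -- receives its own row number.
  set A : ℕ → Finset ℕ := fun c =>
    if c < W then range (B (c + 1) - e c) ∪ Ico (B (c + 1)) (B c) else ∅ with hA
  have hA1 : ∀ c < W, A c = range (B (c + 1) - e c) ∪ Ico (B (c + 1)) (B c) :=
    fun c hc => by simp [hA, hc]
  have hbelow : ∀ c < W, ∀ m, below (A c) m = min m (B (c + 1) - e c) + (min m (B c) - B (c + 1)) := by
    intro c hc m
    rw [hA1 c hc, below_range_union_Ico (by omega) (f1 c hc)]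
  have hsub : ∀ c, A c ⊆ range N := by
    intro c x hx
    by_cases hc : c < W
    · rw [hA1 c hc, mem_range_union_Ico] at hx
      have := f4 c
      have := f4 (c + 1)
      rw [mem_range]
      omega
    · simp [hA, hc] at hx
  -- The intervals from `B (c + 1)` to `B c`, for `c` from `j` on, tile the numbers below `B j`, so
  -- together they contribute each such letter once.
  have hwt : ∀ j x, weightFrom W A j x =
      #{c ∈ Ico j W | x < B (c + 1) - e c} + if x < B j then 1 else 0 := by
    intro j x
    by_cases hj : W ≤ j
    · rw [weightFrom_of_le hj, hB0 j hj, Ico_eq_empty_of_le hj]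
      simp
    · obtain ⟨d, hd⟩ : ∃ d, d = W - j := ⟨_, rfl⟩
      induction d generalizing j with
      | zero => omega
      | succ d ih =>
        have hj' : j < W := by omega
        have hrec : weightFrom W A (j + 1) x =
            #{c ∈ Ico (j + 1) W | x < B (c + 1) - e c} + if x < B (j + 1) then 1 else 0 := by
          by_cases h : W ≤ j + 1
          · rw [weightFrom_of_le h, hB0 _ h, Ico_eq_empty_of_le h]
            simp
          · exact ih (j + 1) h (by omega)
        rw [weightFrom_eq_add hj', hrec, ← Finset.insert_Ico_add_one_left_eq_Ico hj', filter_insert,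
          hA1 j hj']
        simp only [mem_range_union_Ico]
        have := f1 j hj'
        by_cases hx : x < B (j + 1) - e j
        · rw [if_pos hx, card_insert_of_notMem (by simp)]
          split_ifs <;> omega
        · rw [if_neg hx]
          split_ifs <;> omega
  refine ⟨A, ⟨hsub, fun c hc => by simp [hA, not_lt.2 hc], ?_, ?_⟩, ?_, ?_, ?_⟩
  · intro c hc
    rw [← below_of_subset (hsub c) le_rfl, hbelow c hc]
    have := f4 c
    have := f1 c hc
    have := f2 c hc
    have := hB1 c hc
    omega
  · intro c hc m
    rw [hbelow c (by omega), hbelow _ hc, hae c (by omega), hae _ hc]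
    have := f1 c (by omega)
    have := f1 _ hc
    have := f2 c (by omega)
    have := f2 _ hc
    have := f3 c hc
    push_cast
    omega
  · rintro j i ⟨-, h⟩
    rw [hwt, hwt] at h
    have : #{c ∈ Ico j W | i + 1 < B (c + 1) - e c} ≤ #{c ∈ Ico j W | i < B (c + 1) - e c} := by
      refine card_le_card fun c hc => ?_
      rw [mem_filter] at hc ⊢
      exact ⟨hc.1, by omega⟩
    split_ifs at h <;> omega
  · intro x hx
    rw [hwt, if_pos]
    · omega
    · rw [hae 0 hW] at hx
      rw [hB1 0 hW]
      omega
  · intro q hq hq' x hx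
    unfold weightFrom
    rw [filter_true_of_mem, Nat.card_Ico, Nat.sub_zero]
    intro c hc
    rw [mem_Ico] at hc
    rw [hA1 c hc.2, mem_range_union_Ico]
    by_cases h : c + 1 < W
    · left
      have := hq c h
      rw [hae c hc.2, hae _ h] at this
      rw [hB1 _ h]
      omega
    · right
      rw [hB0 _ (by omega), hB1 c hc.2]
      obtain rfl : c = W - 1 := by omega
      omega

end Lattice

/-! ### Cylindric profiles -/

/-- The column heights of a cylindric shape with `k` rows and `r + s + 2` columns in which all
consecutive columns overlap, the minimal overlap `p + 1` being attained between the last column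
and the first one, and the next one, `q`, between the columns `r` and `r + 1`. -/
structure IsCylProfile (k r s p q : ℕ) (a : ℕ → ℤ) (l : ℕ → ℕ) : Prop where
  top : ∀ c, c + 1 < r + s + 2 → a (c + 1) ≤ a c
  bot : ∀ c, c + 1 < r + s + 2 → a (c + 1) + l (c + 1) ≤ a c + l c
  wrap_top : a 0 - k ≤ a (r + s + 1)
  first : a 0 + l 0 - k = a (r + s + 1) + p + 1
  second : a (r + 1) + l (r + 1) = a r + q
  second_le : ∀ c, c + 1 < r + s + 2 → a c + q ≤ a (c + 1) + l (c + 1)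
  lt : p < q

/-- The rows of `A` weakly increase from the last of its `u` columns to the first one, moved up by
`k` rows. -/
def IsWrapped (k u : ℕ) (a : ℕ → ℤ) (A : ℕ → Finset ℕ) : Prop :=
  ∀ m, a 0 - k + (below (A 0) m : ℤ) ≤ a (u - 1) + below (A (u - 1)) m

/-- First rows of the columns of the merged shape. -/
def mergedTop (k r s : ℕ) (a : ℕ → ℤ) (c : ℕ) : ℤ :=
  if c < s then a (c + r + 1) else a (c - s) - k - 1

/-- Column lengths of the merged shape. -/
def mergedLen (r s p : ℕ) (l : ℕ → ℕ) (c : ℕ) : ℕ :=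
  if c < s then l (c + r + 1) else if c = s then l 0 + l (r + s + 1) - p else l (c - s)

/-- `B` is obtained from `A` by removing `0, …, p - 1` from the last column, putting the rest of it
below the first column, and cutting between the columns `r` and `r + 1`. -/
structure IsMerge (r s p q m : ℕ) (A B : ℕ → Finset ℕ) : Prop where
  left : ∀ c < s, B c = A (c + r + 1)
  mid : B s = A 0 ∪ (A (r + s + 1) \ range p)
  right : ∀ c < r, B (s + 1 + c) = A (c + 1)
  empty_left : ∀ c, r + s + 2 ≤ c → A c = ∅
  empty_right : ∀ c, r + s + 1 ≤ c → B c = ∅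
  sub_last : range p ⊆ A (r + s + 1)
  first_sub : A 0 ⊆ range m
  last_lt : ∀ x ∈ A (r + s + 1), x < m → x < p
  sub : ∀ c < r + s + 1, range q ⊆ A c

theorem below_le (A : Finset ℕ) (m : ℕ) : below A m ≤ m := Nat.count_le _

theorem min_le_below {A : Finset ℕ} {q : ℕ} (h : range q ⊆ A) (m : ℕ) : min m q ≤ below A m := by
  rw [below_eq_card_filter]
  calc min m q = #(range (min m q)) := (card_range _).symm
    _ ≤ _ := card_le_card fun x hx => by
      rw [mem_range] at hx
      exact mem_filter.2 ⟨h (mem_range.2 (by omega)), by omega⟩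

/-! ### Merging the first and last columns of a tableau that is not wrapped -/

section Merge

variable {N k r s p q m : ℕ} {a : ℕ → ℤ} {l : ℕ → ℕ} {A B : ℕ → Finset ℕ}

theorem IsCylProfile.le_len (h : IsCylProfile k r s p q a l) {c : ℕ} (hc : c < r + s + 2) :
    q ≤ l c := by
  by_cases hc' : c + 1 < r + s + 2
  · have := h.second_le c hc'
    have := h.bot c hc'
    omega
  · obtain rfl : c = r + s + 1 := by omega
    have := h.second_le (r + s) (by omega)
    have := h.top (r + s) (by omega)
    omega

namespace IsMerge

variable (h : IsMerge r s p q m A B)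

include h

theorem below_last_of_le {t : ℕ} (ht : t ≤ m) : below (A (r + s + 1)) t = min t p := by
  refine le_antisymm ?_ (min_le_below h.sub_last t)
  rw [below_eq_card_filter]
  calc _ ≤ #(range (min t p)) := card_le_card fun x hx => by
        rw [mem_filter] at hx
        have := h.last_lt x hx.1 (by omega)
        rw [mem_range]
        omega
    _ = _ := card_range _

theorem below_first_of_le {t : ℕ} (ht : m ≤ t) : below (A 0) t = #(A 0) :=
  below_of_subset h.first_sub ht

theorem le : q ≤ m := by
  by_contra hlt
  have h1 := h.first_sub (h.sub 0 (by omega) (mem_range.2 (show m < q by omega)))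
  simp at h1

/-- Column 0 lies below `m`, and the part of the last column that is moved lies at or above `m`. So
the union is disjoint, and `min t p` accounts for the removed letters. -/
theorem below_mid (hpq : p < q) (t : ℕ) :
    below (B s) t + min t p = below (A 0) t + below (A (r + s + 1)) t := by
  have hm := h.le
  induction t with
  | zero => simp [below]
  | succ t ih =>
    rw [below_succ, below_succ, below_succ, h.mid]
    rw [h.mid] at ih
    have h1 : t ∈ A 0 → t < m := fun ht => mem_range.1 (h.first_sub ht)
    have h2 := h.last_lt t
    have h3 : t < p → t ∈ A (r + s + 1) := fun ht => h.sub_last (mem_range.2 ht)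
    have h4 : t < p → t ∈ A 0 := fun ht => h.sub 0 (by omega) (mem_range.2 (by omega))
    simp only [mem_union, mem_sdiff, mem_range]
    by_cases c1 : t ∈ A 0 <;> by_cases c2 : t ∈ A (r + s + 1) <;> by_cases c3 : t < p <;>
      simp only [c1, c2, c3, or_true, or_false, and_true, and_false, not_true,
        not_false_eq_true, if_true, if_false] at h1 h2 h3 h4 ⊢ <;> first | omega | tauto

theorem weight (hpq : p < q) (x : ℕ) : weightFrom (r + s + 2) A 0 x =
    weightFrom (r + s + 1) B 0 x + if x < p then 1 else 0 := by
  unfold weightFrom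
  simp only [card_filter, Nat.Ico_zero_eq_range]
  have hm := h.below_mid hpq (x + 1)
  have hm' := h.below_mid hpq x
  rw [below_succ, below_succ, below_succ] at hm
  rw [sum_range_succ, sum_range_succ', sum_range_add, add_right_comm r s 1, add_comm (r + 1) s,
    add_comm r 1, ← add_assoc s 1 r, sum_range_add, sum_range_succ _ s]
  rw [show s + 1 + r = r + s + 1 by omega]
  have e1 : ∑ c ∈ range s, (if x ∈ B c then 1 else 0) =
      ∑ c ∈ range s, if x ∈ A (r + c + 1) then 1 else 0 :=
    sum_congr rfl fun c hc => by rw [h.left c (mem_range.1 hc), add_comm c r]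
  have e2 : ∑ c ∈ range r, (if x ∈ B (s + 1 + c) then 1 else 0) =
      ∑ c ∈ range r, if x ∈ A (c + 1) then 1 else 0 :=
    sum_congr rfl fun c hc => by rw [h.right c (mem_range.1 hc)]
  rw [e1, e2]
  split_ifs at * <;> omega

end IsMerge

/-- Moving the columns 0, …, r up by `k + 1` rows ends column 0 exactly where the letters 0, …, p -
1 of the last column end, so stacking produces one column. The conditions next to it reduce to those
of column 0 for thresholds up to `m` and to those of the last column beyond. The condition between
`r` and `r + 1`, lost by the cut, holds automatically. -/
theorem IsMerge.isColTableau_iff (h : IsMerge r s p q m A B) (hP : IsCylProfile k r s p q a l)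
    (hN : p ≤ N) (h0 : #(A 0) = l 0) :
    IsColTableau N (r + s + 2) a l A ↔
      IsColTableau N (r + s + 1) (mergedTop k r s a) (mergedLen r s p l) B := by
  have hpq := hP.lt
  have hm := h.le
  have hl0 := hP.le_len (c := 0) (by omega)
  have hsub : (∀ c, A c ⊆ range N) ↔ ∀ c, B c ⊆ range N := by
    constructor
    · intro hA c
      rcases lt_trichotomy c s with hc | rfl | hc
      · rw [h.left c hc]; exact hA _
      · rw [h.mid]
        exact union_subset (hA 0) (sdiff_subset.trans (hA _))
      · by_cases hc' : c < r + s + 1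
        · have := h.right (c - (s + 1)) (by omega)
          rw [Nat.add_sub_cancel' (by omega)] at this
          rw [this]; exact hA _
        · rw [h.empty_right c (by omega)]; simp
    · intro hB c
      by_cases c0 : c = 0
      · subst c0
        exact subset_union_left.trans (h.mid ▸ hB s)
      by_cases c1 : c ≤ r
      · have := h.right (c - 1) (by omega)
        rw [Nat.sub_add_cancel (by omega)] at this
        rw [← this]; exact hB _
      by_cases c2 : c ≤ r + s
      · have := h.left (c - (r + 1)) (by omega)
        rw [add_assoc, Nat.sub_add_cancel (by omega)] at this
        rw [← this]; exact hB _
      by_cases c3 : c = r + s + 1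
      · subst c3
        intro x hx
        by_cases hxp : x < p
        · exact mem_range.2 (by omega)
        · refine hB s (h.mid ▸ mem_union_right _ (mem_sdiff.2 ⟨hx, ?_⟩))
          simpa using hxp
      · rw [h.empty_left c (by omega)]; simp
  by_cases hs : ∀ c, A c ⊆ range N
  swap
  · exact ⟨fun hA => absurd hA.subset hs, fun hB => absurd (hsub.2 hB.subset) hs⟩
  have hs' := hsub.1 hs
  have hmidcard : #(B s) + p = #(A 0) + #(A (r + s + 1)) := by
    have := h.below_mid hpq N
    rwa [below_of_subset (hs _) le_rfl, below_of_subset (hs _) le_rfl,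
      below_of_subset (hs' _) le_rfl, min_eq_right hN] at this
  have hlen : (∀ c, c < r + s + 2 → #(A c) = l c) ↔
      ∀ c, c < r + s + 1 → #(B c) = mergedLen r s p l c := by
    unfold mergedLen
    constructor
    · intro hA c hc
      split_ifs with h1 h2
      · rw [h.left c h1, hA _ (by omega)]
      · subst h2
        have := hA (r + c + 1) (by omega)
        omega
      · have := h.right (c - (s + 1)) (by omega)
        rw [Nat.add_sub_cancel' (by omega)] at this
        rw [this, hA _ (by omega)]
        congr 1
        omega
    · intro hB c hc
      by_cases c0 : c = 0
      · rw [c0, h0]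
      by_cases c1 : c ≤ r
      · have h1 := h.right (c - 1) (by omega)
        have h2 := hB (s + 1 + (c - 1)) (by omega)
        rw [if_neg (by omega), if_neg (by omega), h1, Nat.sub_add_cancel (by omega)] at h2
        rw [h2]
        congr 1
        omega
      by_cases c2 : c ≤ r + s
      · have h1 := h.left (c - (r + 1)) (by omega)
        have h2 := hB (c - (r + 1)) (by omega)
        rw [if_pos (by omega), h1, add_assoc, Nat.sub_add_cancel (by omega)] at h2
        exact h2
      · obtain rfl : c = r + s + 1 := by omega
        have h2 := hB s (by omega)
        rw [if_neg (by omega), if_pos rfl] at h2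
        omega
  by_cases hc : ∀ c, c < r + s + 2 → #(A c) = l c
  swap
  · exact ⟨fun hA => absurd hA.card_eq hc, fun hB => absurd (hlen.2 hB.card_eq) hc⟩
  have hc' := hlen.1 hc
  have hrow : (∀ c, c + 1 < r + s + 2 → ∀ t,
      a (c + 1) + (below (A (c + 1)) t : ℤ) ≤ a c + below (A c) t) ↔
      ∀ c, c + 1 < r + s + 1 → ∀ t, mergedTop k r s a (c + 1) + (below (B (c + 1)) t : ℤ) ≤
        mergedTop k r s a c + below (B c) t := by
    unfold mergedTop
    have hfirst := hP.first
    constructor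
    · intro hA c hc t
      rcases lt_trichotomy (c + 1) s with h1 | h1 | h1
      · rw [if_pos h1, if_pos (by omega), h.left _ h1, h.left c (by omega),
          show c + 1 + r + 1 = c + r + 1 + 1 by omega]
        exact hA _ (by omega) t
      · rw [if_neg (by omega), if_pos (by omega), h.left c (by omega), h1, Nat.sub_self]
        have hm1 := h.below_mid hpq t
        have hm2 := hA (r + s) (by omega) t
        rw [show c + r + 1 = r + s by omega]
        have hm3 := below_le_card (A 0) t
        -- For `t ≤ m` column 0 governs the merged column: it ends where the p-th row of the last
        -- column ends, and the left neighbour has at least `min t q` entries below `t`. For `t ≥ m`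
        -- the count is that of the last column.
        rcases le_total t m with ht | ht
        · rw [h.below_last_of_le ht] at hm1 hm2
          have hm4 := min_le_below (h.sub (r + s) (by omega)) t
          by_cases htp : p ≤ t
          · rw [min_eq_right htp] at hm1 hm2
            omega
          · have := below_le (A 0) t
            have := hP.wrap_top
            rw [min_eq_left (by omega)] at hm1 hm2
            omega
        · rw [h.below_first_of_le ht, min_eq_right (by omega)] at hm1
          omega
      · rw [if_neg (by omega), if_neg (by omega)]
        rcases (show s ≤ c by omega).eq_or_lt with rfl | h2
        · rw [Nat.sub_self, Nat.add_sub_cancel_left]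
          have hr := h.right 0 (by omega)
          rw [add_zero, zero_add] at hr
          rw [hr]
          have hm1 := h.below_mid hpq t
          have hm2 := hA 0 (by omega) t
          have hm3 := min_le_below h.sub_last t
          rw [zero_add] at hm2
          omega
        · have e1 := h.right (c - s) (by omega)
          have e2 := h.right (c - s - 1) (by omega)
          rw [show s + 1 + (c - s) = c + 1 by omega] at e1
          rw [show s + 1 + (c - s - 1) = c by omega, show c - s - 1 + 1 = c - s by omega] at e2
          rw [e1, e2, show c + 1 - s = c - s + 1 by omega]
          have := hA (c - s) (by omega) t
          omega
    · intro hB c hc1 t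
      rcases lt_trichotomy c r with h1 | rfl | h1
      · have hb := hB (s + c) (by omega) t
        rw [if_neg (by omega), if_neg (by omega)] at hb
        have e1 := h.right c h1
        rw [show s + c + 1 = s + 1 + c by omega, e1, show s + 1 + c - s = c + 1 by omega,
          Nat.add_sub_cancel_left] at hb
        rcases Nat.eq_zero_or_pos c with rfl | h2
        · rw [add_zero] at hb
          rw [zero_add] at hb ⊢
          have hm1 := h.below_mid hpq t
          rcases le_total t m with ht | ht
          · rw [h.below_last_of_le ht] at hm1
            omega
          · rw [h.below_first_of_le ht, h0]
            have := below_le_card (A 1) t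
            rw [hc 1 (by omega)] at this
            have := hP.bot 0 (by omega)
            rw [zero_add] at this
            omega
        · have e2 := h.right (c - 1) (by omega)
          rw [show s + 1 + (c - 1) = s + c by omega, Nat.sub_add_cancel h2] at e2
          rw [e2] at hb
          omega
      -- The pair that is cut apart: its left column starts with the least possible entries 0, …, q
      -- - 1, and these fill all the `q` shared rows.
      · have h2 := min_le_below (h.sub c (by omega)) t
        have h3 := hP.second
        have h4 := below_le_card (A (c + 1)) t
        rw [hc _ hc1] at h4
        have h5 := hP.top c hc1
        have h6 := below_le (A (c + 1)) t
        rcases le_total t q with ht | ht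
        · rw [min_eq_left ht] at h2
          omega
        · rw [min_eq_right ht] at h2
          omega
      · have e1 := h.left (c - (r + 1)) (by omega)
        rw [add_assoc, Nat.sub_add_cancel (by omega)] at e1
        have hb := hB (c - (r + 1)) (by omega) t
        rw [if_pos (show c - (r + 1) < s by omega), e1,
          show c - (r + 1) + r + 1 = c by omega] at hb
        by_cases h2 : c < r + s
        · rw [if_pos (by omega)] at hb
          have e2 := h.left (c - r) (by omega)
          rw [show c - r + r + 1 = c + 1 by omega] at e2
          rw [show c - (r + 1) + 1 = c - r by omega, e2,
            show c - r + r + 1 = c + 1 by omega] at hb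
          exact hb
        · obtain rfl : c = r + s := by omega
          rw [if_neg (by omega), show r + s - (r + 1) + 1 = s by omega, Nat.sub_self] at hb
          have hm1 := h.below_mid hpq t
          rcases le_total t m with ht | ht
          · rw [h.below_last_of_le ht]
            have h3 := min_le_below (h.sub (r + s) (by omega)) t
            have h4 := hP.top (r + s) (by omega)
            have h5 : min t p ≤ min t q := min_le_min_left t hpq.le
            omega
          · rw [h.below_first_of_le ht, min_eq_right (by omega)] at hm1
            omega
  exact ⟨fun hA => ⟨hs', h.empty_right, hc', hrow.1 hA.row⟩,
    fun hB => ⟨hs, h.empty_left, hc, hrow.2 hB.row⟩⟩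

/-- The threshold `m` witnesses the violation: all of column 0 is below it, but only `p` entries of
the last column are, and the overlap has `p + 1` rows. -/
theorem IsMerge.not_isWrapped (h : IsMerge r s p q m A B) (hP : IsCylProfile k r s p q a l)
    (h0 : #(A 0) = l 0) : ¬ IsWrapped k (r + s + 2) a A := by
  intro hw
  have h1 := hw m
  have h2 := h.le
  have h3 := hP.lt
  have h4 := hP.first
  rw [show r + s + 2 - 1 = r + s + 1 by omega, h.below_last_of_le le_rfl,
    h.below_first_of_le le_rfl, h0, min_eq_right (by omega)] at h1
  omega

/-- The merge of `A`. -/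
def mergeCols (r s p : ℕ) (A : ℕ → Finset ℕ) (c : ℕ) : Finset ℕ :=
  if c < s then A (c + r + 1) else if c = s then A 0 ∪ (A (r + s + 1) \ range p)
    else if c < r + s + 1 then A (c - s) else ∅

/-- The inverse of `mergeCols`, when the first column has `n` elements. -/
def unmergeCols (r s p n : ℕ) (B : ℕ → Finset ℕ) (c : ℕ) : Finset ℕ :=
  if c = 0 then {x ∈ B s | below (B s) x < n} else if c ≤ r then B (s + c)
    else if c ≤ r + s then B (c - (r + 1))
    else if c = r + s + 1 then range p ∪ {x ∈ B s | n ≤ below (B s) x} else ∅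

theorem IsMerge.mergeCols_eq (h : IsMerge r s p q m A B) : mergeCols r s p A = B := by
  funext c
  unfold mergeCols
  split_ifs with h1 h2 h3
  · rw [h.left c h1]
  · rw [h2, h.mid]
  · have := h.right (c - (s + 1)) (by omega)
    rw [Nat.add_sub_cancel' (by omega), show c - (s + 1) + 1 = c - s by omega] at this
    rw [this]
  · rw [h.empty_right c (by omega)]

/-- Since `m` separates column 0 from what is put below it, column 0 consists of the smallest
entries of the merged column, and its size suffices to recover it. -/
theorem IsMerge.unmergeCols_eq (h : IsMerge r s p q m A B) (hpq : p < q) :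
    unmergeCols r s p #(A 0) B = A := by
  have key : ∀ x, x ∈ B s → (below (B s) x < #(A 0) ↔ x ∈ A 0) := by
    intro x hx
    have h1 := h.below_mid hpq x
    have hm := h.le
    constructor
    · intro hlt
      by_contra hx0
      have hx1 : x ∈ A (r + s + 1) ∧ x ∉ range p := by
        rw [h.mid] at hx
        simpa [hx0] using hx
      have hxm : m ≤ x := by
        by_contra hlt
        exact hx1.2 (mem_range.2 (h.last_lt x hx1.1 (by omega)))
      have := min_le_below h.sub_last x
      rw [h.below_first_of_le hxm] at h1
      omega
    · intro hx0
      have hxm := mem_range.1 (h.first_sub hx0)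
      rw [h.below_last_of_le hxm.le] at h1
      have h2 := below_le_card (A 0) (x + 1)
      rw [below_succ, if_pos hx0] at h2
      omega
  funext c
  unfold unmergeCols
  split_ifs with h1 h2 h3 h4
  · subst h1
    ext x
    rw [mem_filter]
    constructor
    · rintro ⟨hx, hx'⟩
      exact (key x hx).1 hx'
    · intro hx
      have hx' : x ∈ B s := h.mid ▸ mem_union_left _ hx
      exact ⟨hx', (key x hx').2 hx⟩
  · have := h.right (c - 1) (by omega)
    rw [show s + 1 + (c - 1) = s + c by omega, show c - 1 + 1 = c by omega] at this
    rw [this]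
  · rw [h.left _ (by omega), show c - (r + 1) + r + 1 = c by omega]
  · subst h4
    ext x
    rw [mem_union, mem_filter, mem_range]
    constructor
    · rintro (hx | ⟨hx, hx'⟩)
      · exact h.sub_last (mem_range.2 hx)
      · have : x ∉ A 0 := fun h0 => by have := (key x hx).2 h0; omega
        rw [h.mid] at hx
        simp only [mem_union, this, mem_sdiff, false_or] at hx
        exact hx.1
    · intro hx
      by_cases hxp : x < p
      · exact Or.inl hxp
      · have hx' : x ∈ B s := h.mid ▸ mem_union_right _ (mem_sdiff.2 ⟨hx, by simpa using hxp⟩)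
        refine Or.inr ⟨hx', not_lt.1 fun hlt => ?_⟩
        exact hxp (h.last_lt x hx (mem_range.1 (h.first_sub ((key x hx').1 hlt))))
  · rw [h.empty_left c (by omega)]

theorem exists_below_eq (M : Finset ℕ) {n : ℕ} (hn : n ≤ #M) : ∃ m, below M m = n := by
  induction n with
  | zero => exact ⟨0, by simp [below]⟩
  | succ n ih =>
    obtain ⟨m, hm⟩ := ih (by omega)
    have hex : ∃ t, n < below M t := by
      obtain ⟨t, ht⟩ := M.exists_nat_subset_range
      exact ⟨t, by rw [below_of_subset ht le_rfl]; omega⟩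
    have h1 := Nat.find_spec hex
    have h2 := Nat.find_min hex (m := Nat.find hex - 1)
    have h3 : Nat.find hex ≠ 0 := by
      intro h0
      rw [h0] at h1
      simp [below] at h1
    have h4 := below_succ M (Nat.find hex - 1)
    rw [Nat.sub_add_cancel (by omega)] at h4
    refine ⟨Nat.find hex, ?_⟩
    have h5 := h2 (by omega)
    split_ifs at h4 <;> omega

/-- Take `m` with exactly `n` entries of the merged column below it. As `q ≤ n`, the letters 0, …, q
- 1 stay in column 0. -/
theorem isMerge_unmergeCols (hpq : p < q) {n : ℕ} (hn : q ≤ n) (hcard : n ≤ #(B s))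
    (hsub : ∀ c < r + s + 1, range q ⊆ B c) (hempty : ∀ c, r + s + 1 ≤ c → B c = ∅) :
    ∃ m, IsMerge r s p q m (unmergeCols r s p n B) B ∧ #(unmergeCols r s p n B 0) = n := by
  obtain ⟨m, hm⟩ := exists_below_eq (B s) hcard
  have key : ∀ x ∈ B s, below (B s) x < n ↔ x < m := by
    intro x hx
    constructor
    · intro h
      by_contra hle
      have := below_mono (B s) (not_lt.1 hle)
      omega
    · intro h
      have := below_mono (B s) (show x + 1 ≤ m from h)
      rw [below_succ, if_pos hx] at this
      omega
  have hB := hsub s (by omega)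
  have hqm : q ≤ m := by
    have := below_le (B s) m
    omega
  have u0 : unmergeCols r s p n B 0 = {x ∈ B s | x < m} := by
    simp only [unmergeCols, if_true]
    exact filter_congr key
  have ul : unmergeCols r s p n B (r + s + 1) = range p ∪ {x ∈ B s | m ≤ x} := by
    unfold unmergeCols
    rw [if_neg (by omega), if_neg (by omega), if_neg (by omega), if_pos rfl]
    congr 1
    refine filter_congr fun x hx => ?_
    have := key x hx
    omega
  refine ⟨m, ⟨?_, ?_, ?_, ?_, hempty, ?_, ?_, ?_, ?_⟩, ?_⟩
  · intro c hc
    unfold unmergeCols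
    rw [if_neg (by omega), if_neg (by omega), if_pos (by omega)]
    congr 1
    omega
  · rw [u0, ul]
    ext x
    have : x < p → x ∈ B s := fun h => hB (mem_range.2 (by omega))
    simp only [mem_union, mem_filter, mem_sdiff, mem_range]
    by_cases x < m <;> by_cases x ∈ B s <;> by_cases x < p <;> grind
  · intro c hc
    unfold unmergeCols
    rw [if_neg (by omega), if_pos (by omega)]
    congr 1
    omega
  · intro c hc
    unfold unmergeCols
    rw [if_neg (by omega), if_neg (by omega), if_neg (by omega), if_neg (by omega)]
  · rw [ul]
    exact subset_union_left
  · rw [u0]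
    intro x hx
    exact mem_range.2 (mem_filter.1 hx).2
  · intro x hx hxm
    rw [ul, mem_union, mem_filter, mem_range] at hx
    omega
  · intro c hc
    unfold unmergeCols
    split_ifs with h1 h2 h3 h4
    · intro x hx
      have hx' := hB hx
      rw [mem_range] at hx
      exact mem_filter.2 ⟨hx', (key x hx').2 (by omega)⟩
    · exact hsub _ (by omega)
    · exact hsub _ (by omega)
    · omega
    · omega
  · rw [u0, ← hm, below_eq_card_filter]

end Merge

/-! ### The alternating sum over wrapped tableaux -/

section Core

variable {N k r s p q : ℕ} {a : ℕ → ℤ} {l : ℕ → ℕ} {A B : ℕ → Finset ℕ}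

theorem weightFrom_zero_le (W : ℕ) (A : ℕ → Finset ℕ) (x : ℕ) : weightFrom W A 0 x ≤ W := by
  exact (card_filter_le _ _).trans (by simp)

theorem mem_of_weightFrom_eq {W : ℕ} {A : ℕ → Finset ℕ} {x : ℕ} (h : weightFrom W A 0 x = W)
    {c : ℕ} (hc : c < W) : x ∈ A c := by
  have h1 : #{c ∈ Ico 0 W | x ∈ A c} = #(Ico 0 W) := by
    rw [Nat.card_Ico]
    exact h
  exact card_filter_eq_iff.1 h1 c (mem_Ico.2 ⟨by omega, hc⟩)

theorem weightFrom_eq_of_mem {W : ℕ} {A : ℕ → Finset ℕ} {x : ℕ} (h : ∀ c < W, x ∈ A c) :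
    weightFrom W A 0 x = W := by
  unfold weightFrom
  rw [filter_true_of_mem fun c hc => h c (mem_Ico.1 hc).2, Nat.card_Ico, Nat.sub_zero]

/-- If `x` misses the column `d` and lies in all columns but one, it lies in all other columns. -/
theorem mem_of_weightFrom_add_one {W : ℕ} {A : ℕ → Finset ℕ} {x : ℕ}
    (h : weightFrom W A 0 x + 1 = W) {d c : ℕ} (hd : d < W) (hxd : x ∉ A d) (hc : c < W)
    (hcd : c ≠ d) : x ∈ A c := by
  by_contra hxc
  have h1 : {c ∈ Ico 0 W | x ∈ A c} ⊆ ((range W).erase d).erase c := by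
    intro e he
    rw [mem_filter, mem_Ico] at he
    rw [mem_erase, mem_erase, mem_range]
    exact ⟨fun h => hxc (h ▸ he.2), fun h => hxd (h ▸ he.2), he.1.2⟩
  have h2 := card_le_card h1
  rw [card_erase_of_mem (mem_erase.2 ⟨hcd, mem_range.2 hc⟩), card_erase_of_mem (mem_range.2 hd),
    card_range] at h2
  unfold weightFrom at h
  omega

theorem weightFrom_succ_lt_of_notMem {W : ℕ} {A : ℕ → Finset ℕ} {x d : ℕ} (hd : d < W)
    (hxd : x ∉ A d) : weightFrom W A 0 x < W := by
  refine (weightFrom_zero_le W A x).lt_of_ne fun h => hxd (mem_of_weightFrom_eq h hd)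

/-- The tableaux that are not wrapped and contribute to the alternating sum can be merged. -/
theorem exists_isMerge (hP : IsCylProfile k r s p q a l) (hN : q ≤ N) {ν : ℕ → ℕ}
    (hν1 : ∀ i < p, ν i = r + s + 2) (hν2 : ∀ i, p ≤ i → i < q → ν i = r + s + 1)
    (hA : IsColTableau N (r + s + 2) a l A) (hw : ¬ IsWrapped k (r + s + 2) a A)
    (hne : altSum N ν (weightFrom (r + s + 2) A 0) ≠ 0) :
    ∃ m, IsMerge r s p q m A (mergeCols r s p A) := by
  have hpq := hP.lt
  have h1 : ∀ i < p, weightFrom (r + s + 2) A 0 i = r + s + 2 := by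
    intro i hi
    rw [eq_of_altSum_ne_zero_of_le (q := p) (by omega) _ hne hi, hν1 i hi]
    intro i hi j _ _
    rw [hν1 i hi]
    exact weightFrom_zero_le _ _ _
  have hsubp : ∀ c < r + s + 2, range p ⊆ A c := fun c hc x hx =>
    mem_of_weightFrom_eq (h1 x (mem_range.1 hx)) hc
  have hl0 := hP.le_len (c := 0) (by omega)
  have h0 := hA.card_eq 0 (by omega)
  obtain ⟨m, hm⟩ : ∃ m, a (r + s + 1) + (below (A (r + s + 1)) m : ℤ) < a 0 - k + below (A 0) m := by
    unfold IsWrapped at hw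
    push Not at hw
    exact hw
  have hfirst := hP.first
  have hb0 := below_le_card (A 0) m
  have hbl := min_le_below (hsubp (r + s + 1) (by omega)) m
  have hb0' := below_le (A 0) m
  have hpm : p ≤ m := by
    by_contra hlt
    rw [min_eq_left (by omega)] at hbl
    omega
  rw [min_eq_right hpm] at hbl
  -- The overlap has `p + 1` rows and the last column has at least `p` entries below `m`. So the
  -- wrap condition can fail at `m` only if column 0 lies entirely below `m` and the last column has
  -- exactly `p` entries there.
  have hfsub : A 0 ⊆ range m := by
    have h2 : below (A 0) m = #(A 0) := by omega
    rw [below_eq_card_filter] at h2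
    intro x hx
    exact mem_range.2 (card_filter_eq_iff.1 h2 x hx)
  have hlast : ∀ x ∈ A (r + s + 1), x < m → x < p := by
    have h2 : below (A (r + s + 1)) m = p := by omega
    rw [below_eq_card_filter] at h2
    have h3 : range p = {x ∈ A (r + s + 1) | x < m} := by
      refine eq_of_subset_of_card_le (fun x hx => mem_filter.2
        ⟨hsubp (r + s + 1) (by omega) hx, ?_⟩) (by rw [h2, card_range])
      rw [mem_range] at hx
      omega
    intro x hx hxm
    have : x ∈ range p := h3 ▸ mem_filter.2 ⟨hx, hxm⟩
    exact mem_range.1 this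
  have hdisj : ∀ x, p ≤ x → x ∈ A 0 → x ∉ A (r + s + 1) := fun x hx hx0 hxl => by
    have := hlast x hxl (mem_range.1 (hfsub hx0))
    omega
  -- Every letter from `p` on misses column 0 or the last one. This makes the parts p, …, q - 1 of ν
  -- maximal too, so they are forced as well.
  have hlt : ∀ x, p ≤ x → weightFrom (r + s + 2) A 0 x ≤ r + s + 1 := by
    intro x hx
    by_cases hx0 : x ∈ A 0
    · have := weightFrom_succ_lt_of_notMem (W := r + s + 2) (d := r + s + 1) (by omega)
        (hdisj x hx hx0)
      omega
    · have := weightFrom_succ_lt_of_notMem (W := r + s + 2) (d := 0) (by omega) hx0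
      omega
  have h2 : ∀ i < q, p ≤ i → weightFrom (r + s + 2) A 0 i + 1 = r + s + 2 := by
    intro i hi hpi
    rw [eq_of_altSum_ne_zero_of_le (q := q) hN _ hne hi, hν2 i hpi hi]
    intro i hi j hij _
    by_cases hip : i < p
    · rw [hν1 i hip]
      exact weightFrom_zero_le _ _ _
    · rw [hν2 i (by omega) hi]
      exact hlt j (by omega)
  have hsubq : ∀ c < r + s + 1, range q ⊆ A c := by
    intro c hc x hx
    rw [mem_range] at hx
    by_cases hxp : x < p
    · exact hsubp c (by omega) (mem_range.2 hxp)
    · have hxl : x ∉ A (r + s + 1) := by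
        intro hxl
        have hmx : m ≤ x := by
          by_contra hcon
          exact hxp (hlast x hxl (by omega))
        have := card_le_card hfsub
        rw [card_range] at this
        omega
      exact mem_of_weightFrom_add_one (h2 x hx (by omega)) (d := r + s + 1) (by omega) hxl
        (by omega) (by omega)
  refine ⟨m, ?_, ?_, ?_, hA.eq_empty, ?_, hsubp _ (by omega), hfsub, hlast, hsubq⟩
  · intro c hc
    rw [mergeCols, if_pos hc]
  · rw [mergeCols, if_neg (by omega), if_pos rfl]
  · intro c hc
    rw [mergeCols, if_neg (by omega), if_neg (by omega), if_pos (by omega)]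
    congr 1
    omega
  · intro c hc
    rw [mergeCols, if_neg (by omega), if_neg (by omega), if_neg (by omega)]

-- The first `q` parts of μ and ν are as large as the weights of the tableaux in question allow.
-- This forces 0, …, q - 1 into all columns, except that those from `p` on miss the last column
-- before merging, so merging and its inverse are defined on all contributing terms. Merging lowers
-- the weights of the first `p` letters by 1, which is the passage from ν to μ.
open Classical in
theorem sum_not_isWrapped (hP : IsCylProfile k r s p q a l) (hN : q ≤ N) {μ ν : ℕ → ℕ}
    (hμ : Antitone μ) (hμq : ∀ i < q, μ i = r + s + 1)
    (hν : ∀ i, ν i = μ i + if i < p then 1 else 0) :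
    ∑ A ∈ colTableaux N (r + s + 2) a l with ¬ IsWrapped k (r + s + 2) a A,
        altSum N ν (weightFrom (r + s + 2) A 0) =
      ∑ B ∈ colTableaux N (r + s + 1) (mergedTop k r s a) (mergedLen r s p l),
        altSum N μ (weightFrom (r + s + 1) B 0) := by
  have hpq := hP.lt
  have hν1 : ∀ i < p, ν i = r + s + 2 := fun i hi => by rw [hν, hμq i (by omega), if_pos hi]
  have hν2 : ∀ i, p ≤ i → i < q → ν i = r + s + 1 := fun i h1 h2 => by
    rw [hν, hμq i h2, if_neg (by omega), add_zero]
  have hwB : ∀ {m A B}, IsMerge r s p q m A B → ∀ i < q, weightFrom (r + s + 1) B 0 i = r + s + 1 := by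
    intro m A B h i hi
    refine weightFrom_eq_of_mem fun c hc => ?_
    rcases lt_trichotomy c s with h1 | rfl | h1
    · rw [h.left c h1]
      exact h.sub _ (by omega) (mem_range.2 hi)
    · rw [h.mid]
      exact mem_union_left _ (h.sub 0 (by omega) (mem_range.2 hi))
    · have := h.right (c - (s + 1)) (by omega)
      rw [Nat.add_sub_cancel' (by omega)] at this
      rw [this]
      exact h.sub _ (by omega) (mem_range.2 hi)
  have halt : ∀ {m A B}, IsMerge r s p q m A B → altSum N ν (weightFrom (r + s + 2) A 0) =
      altSum N μ (weightFrom (r + s + 1) B 0) := fun {m A B} h =>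
    altSum_add_initial hμ (fun i hi => by rw [hwB h i (by omega), hμq i (by omega)]) hν
      (h.weight hpq)
  refine sum_bij_ne_zero (fun A _ _ => mergeCols r s p A) ?_ ?_ ?_ ?_
  · intro A hA hne
    rw [mem_filter, mem_colTableaux] at hA
    obtain ⟨m, hm⟩ := exists_isMerge hP hN hν1 hν2 hA.1 hA.2 hne
    rw [mem_colTableaux]
    exact (hm.isColTableau_iff hP (by omega) (hA.1.card_eq 0 (by omega))).1 hA.1
  · intro A hA hne A' hA' hne' heq
    rw [mem_filter, mem_colTableaux] at hA hA'
    obtain ⟨m, hm⟩ := exists_isMerge hP hN hν1 hν2 hA.1 hA.2 hne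
    obtain ⟨m', hm'⟩ := exists_isMerge hP hN hν1 hν2 hA'.1 hA'.2 hne'
    rw [← hm.unmergeCols_eq hpq, ← hm'.unmergeCols_eq hpq, heq, hA.1.card_eq 0 (by omega),
      hA'.1.card_eq 0 (by omega)]
  · intro B hB hne
    rw [mem_colTableaux] at hB
    have hsub : ∀ c < r + s + 1, range q ⊆ B c := by
      intro c hc x hx
      rw [mem_range] at hx
      refine mem_of_weightFrom_eq ?_ hc
      rw [eq_of_altSum_ne_zero_of_le hN _ hne hx, hμq x hx]
      intro i hi j _ _
      rw [hμq i hi]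
      exact weightFrom_zero_le _ _ _
    have hBs := hB.card_eq s (by omega)
    rw [mergedLen, if_neg (by omega), if_pos rfl] at hBs
    have hl0 := hP.le_len (c := 0) (by omega)
    have hll := hP.le_len (c := r + s + 1) (by omega)
    obtain ⟨m, hm, h0⟩ := isMerge_unmergeCols (r := r) (s := s) hpq hl0 (by omega) hsub hB.eq_empty
    have hA := (hm.isColTableau_iff hP (by omega) h0).2 hB
    refine ⟨unmergeCols r s p (l 0) B, ?_, ?_, hm.mergeCols_eq⟩
    · rw [mem_filter, mem_colTableaux]
      exact ⟨hA, hm.not_isWrapped hP h0⟩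
    · rwa [halt hm]
  · intro A hA hne
    rw [mem_filter, mem_colTableaux] at hA
    obtain ⟨m, hm⟩ := exists_isMerge hP hN hν1 hν2 hA.1 hA.2 hne
    exact halt hm

/-- Consecutive columns of the merged shape still share at least `q` rows, so `exists_isLattice`
applies. -/
theorem exists_lattice_merged (hP : IsCylProfile k r s p q a l) (hN : k + 1 + q ≤ N) :
    ∃ B, IsColTableau N (r + s + 1) (mergedTop k r s a) (mergedLen r s p l) B ∧
      IsLattice N (r + s + 1) B ∧ (∀ x < k + 1 + q, 0 < weightFrom (r + s + 1) B 0 x) ∧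
      ∀ x < q, weightFrom (r + s + 1) B 0 x = r + s + 1 := by
  have hpq := hP.lt
  have hfirst := hP.first
  have hlast := hP.le_len (c := r + s + 1) (by omega)
  have hl0 := hP.le_len (c := 0) (by omega)
  have e1 : ∀ c < s, mergedTop k r s a c = a (c + r + 1) := fun c hc => if_pos hc
  have e2 : ∀ c, mergedTop k r s a (s + c) = a c - k - 1 := fun c => by
    rw [mergedTop, if_neg (by omega), Nat.add_sub_cancel_left]
  have e3 : ∀ c < s, mergedLen r s p l c = l (c + r + 1) := fun c hc => if_pos hc
  have e4 : mergedLen r s p l s = l 0 + l (r + s + 1) - p := by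
    rw [mergedLen, if_neg (by omega), if_pos rfl]
  have e5 : ∀ c, 0 < c → mergedLen r s p l (s + c) = l c := fun c hc => by
    rw [mergedLen, if_neg (by omega), if_neg (by omega), Nat.add_sub_cancel_left]
  have hadj : ∀ c, c + 1 < r + s + 1 →
      mergedTop k r s a (c + 1) ≤ mergedTop k r s a c ∧
      mergedTop k r s a (c + 1) + mergedLen r s p l (c + 1) ≤
        mergedTop k r s a c + mergedLen r s p l c ∧
      mergedTop k r s a c + q ≤ mergedTop k r s a (c + 1) + mergedLen r s p l (c + 1) := by
    intro c hc
    rcases lt_or_ge c s with h1 | h1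
    · have t1 := hP.top (c + r + 1) (by omega)
      have t2 := hP.bot (c + r + 1) (by omega)
      have t3 := hP.second_le (c + r + 1) (by omega)
      rw [e1 c h1, e3 c h1]
      rcases (show c + 1 ≤ s from h1).eq_or_lt with h2 | h2
      · have t4 := e2 0
        rw [add_zero] at t4
        rw [h2, e4, t4]
        rw [show c + r + 1 + 1 = r + s + 1 by omega] at t1 t2 t3
        have := hP.wrap_top
        omega
      · rw [e1 _ h2, e3 _ h2, show c + 1 + r + 1 = c + r + 1 + 1 by omega]
        exact ⟨t1, t2, t3⟩
    · obtain ⟨d, rfl⟩ := Nat.exists_eq_add_of_le h1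
      have t1 := hP.top d (by omega)
      have t2 := hP.bot d (by omega)
      have t3 := hP.second_le d (by omega)
      rw [add_assoc, e2, e2, e5 (d + 1) (by omega)]
      rcases Nat.eq_zero_or_pos d with rfl | hd
      · rw [add_zero, e4]
        omega
      · rw [e5 d hd]
        omega
  -- The shape starts at the top of the old column `r`, moved up by `k + 1`, and ends at the bottom
  -- of the old column `r + 1`. These two columns overlap in `q` rows, which gives `k + 1 + q` rows.
  have htop : mergedTop k r s a 0 + mergedLen r s p l 0 =
      mergedTop k r s a (r + s + 1 - 1) + (k + 1 + q) := by
    have h2 := hP.second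
    rw [show r + s + 1 - 1 = s + r by omega, e2]
    rcases Nat.eq_zero_or_pos s with rfl | hs
    · have := e2 0
      rw [add_zero] at this
      rw [e4, this]
      simp only [Nat.add_zero] at hfirst hlast ⊢
      omega
    · rw [e1 0 hs, e3 0 hs, zero_add]
      omega
  obtain ⟨B, h1, h2, h3, h4⟩ := exists_isLattice (N := N) (W := r + s + 1)
    (a := mergedTop k r s a) (l := mergedLen r s p l) (by omega) (fun c hc => (hadj c hc).1)
    (fun c hc => (hadj c hc).2.1) (fun c hc => by have := (hadj c hc).2.2; omega)
    (by rw [htop]; omega)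
  refine ⟨B, h1, h2, fun x hx => h3 x (by rw [htop]; omega), h4 q (fun c hc => (hadj c hc).2.2) ?_⟩
  rw [show r + s + 1 - 1 = s + r by omega]
  rcases Nat.eq_zero_or_pos r with rfl | hr
  · rw [add_zero, e4]
    omega
  · rw [e5 r hr]
    exact hP.le_len (by omega)

open Classical in
/-- Some alternating sum over the cylindric tableaux is negative. -/
theorem exists_sum_isWrapped_neg (hP : IsCylProfile k r s p q a l) (hN : k + 1 + q ≤ N) :
    ∃ ν : ℕ → ℕ, Antitone ν ∧
      ∑ A ∈ colTableaux N (r + s + 2) a l with IsWrapped k (r + s + 2) a A,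
        altSum N ν (weightFrom (r + s + 2) A 0) < 0 := by
  have hpq := hP.lt
  have hfirst := hP.first
  obtain ⟨B, hB, hBl, hB1, hB2⟩ := exists_lattice_merged hP hN
  set μ := weightFrom (r + s + 1) B 0 with hμdef
  have hμ : Antitone μ := by
    refine antitone_nat_of_succ_le fun i => ?_
    by_cases hi : i + 1 < N
    · exact hBl.weightFrom_succ_le 0 hi
    · have : weightFrom (r + s + 1) B 0 (i + 1) = 0 := by
        refine card_eq_zero.2 (filter_eq_empty_iff.2 fun c _ hx => ?_)
        exact hi (mem_range.1 (hB.subset c hx))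
      rw [hμdef, this]
      omega
  refine ⟨fun i => μ i + if i < p then 1 else 0, ?_, ?_⟩
  · intro x y hxy
    have := hμ hxy
    simp only
    split_ifs <;> omega
  · have hsum := sum_filter_add_sum_filter_not (colTableaux N (r + s + 2) a l)
      (IsWrapped k (r + s + 2) a)
      (fun A => altSum N (fun i => μ i + if i < p then 1 else 0) (weightFrom (r + s + 2) A 0))
    -- The sum over all tableaux vanishes because ν has a positive part at the index `k + 1 + p`,
    -- which is the number of rows of the cut shape.
    rw [sum_not_isWrapped hP (by omega) hμ hB2 (fun i => rfl), sum_altSum_eq_zero N (r + s + 2) a l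
      (x := k + 1 + p) _ (by omega)] at hsum
    · have := one_le_sum_altSum hμ hB hBl rfl
      omega
    · have := hB1 (k + 1 + p) (by omega)
      omega
    · rw [show r + s + 2 - 1 = r + s + 1 by omega]
      push_cast
      omega
    · intro x y hxy
      have := hμ hxy
      simp only
      split_ifs <;> omega

end Core

/-! ### Increasing sequences and finite sets -/

/-- The `r`-th smallest element of `A`. -/
noncomputable def nthElt (A : Finset ℕ) (r : ℕ) : ℕ := Nat.nth (· ∈ A) r

theorem lt_card_toFinset {A : Finset ℕ} {r : ℕ} (h : r < #A)
    (hf : (Set.ofPred (· ∈ A)).Finite) : r < #hf.toFinset := by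
  have : hf.toFinset = A := by
    ext x
    rw [Set.Finite.mem_toFinset]
    rfl
  rwa [this]

theorem nthElt_mem {A : Finset ℕ} {r : ℕ} (h : r < #A) : nthElt A r ∈ A :=
  Nat.nth_mem r (lt_card_toFinset h)

theorem below_nthElt {A : Finset ℕ} {r : ℕ} (h : r < #A) : below A (nthElt A r) = r :=
  Nat.count_nth (lt_card_toFinset h)

theorem nthElt_below {A : Finset ℕ} {x : ℕ} (h : x ∈ A) : nthElt A (below A x) = x :=
  Nat.nth_count (p := (· ∈ A)) h

theorem nthElt_lt_nthElt {A : Finset ℕ} {r r' : ℕ} (h : r < r') (h' : r' < #A) :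
    nthElt A r < nthElt A r' :=
  Nat.nth_lt_nth' h (lt_card_toFinset h')

theorem below_lt_card {A : Finset ℕ} {x : ℕ} (h : x ∈ A) : below A x < #A := by
  have := below_le_card A (x + 1)
  rw [below_succ, if_pos h] at this
  omega

/-- An entry exceeds its right neighbour exactly when some threshold separates them. The hypotheses
on the ends of the columns ensure that a row detected by the counts meets both columns. -/
theorem forall_nthElt_le_iff {A B : Finset ℕ} {x y : ℤ} (h0 : y ≤ x) (h1 : y + #B ≤ x + #A) :
    (∀ r < #A, ∀ r' < #B, x + (r : ℤ) = y + r' → nthElt A r ≤ nthElt B r') ↔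
      ∀ m, y + (below B m : ℤ) ≤ x + below A m := by
  constructor
  · intro h m
    by_contra hlt
    have hB := below_le_card B m
    obtain ⟨r', hr'⟩ : ∃ r' : ℕ, x + (below A m : ℤ) = y + r' :=
      ⟨(x + below A m - y).toNat, by omega⟩
    have h2 := h (below A m) (by omega) r' (by omega) hr'
    have h3 : nthElt B r' < m := Nat.nth_lt_of_lt_count (p := (· ∈ B)) (show r' < below B m by omega)
    have h4 := below_mono A (show nthElt A (below A m) + 1 ≤ m by omega)
    rw [below_succ, below_nthElt (by omega), if_pos (nthElt_mem (by omega))] at h4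
    omega
  · intro h r hr r' hr' hrr
    by_contra hlt
    have h2 := h (nthElt B r' + 1)
    rw [below_succ, below_nthElt hr', if_pos (nthElt_mem hr')] at h2
    have h3 := below_mono A (show nthElt B r' + 1 ≤ nthElt A r by omega)
    rw [below_nthElt hr] at h3
    push_cast at h2
    omega

section Image

variable {f : ℕ → ℕ} {n : ℕ}

theorem card_image_range (hf : ∀ r r', r < r' → r' < n → f r < f r') :
    #((range n).image f) = n := by
  rw [card_image_of_injOn, card_range]
  intro r hr r' hr' h
  rw [mem_coe, mem_range] at hr hr'
  rcases lt_trichotomy r r' with h1 | h1 | h1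
  · have := hf r r' h1 hr'; omega
  · exact h1
  · have := hf r' r h1 hr; omega

theorem below_image_range (hf : ∀ r r', r < r' → r' < n → f r < f r') {r : ℕ} (hr : r < n) :
    below ((range n).image f) (f r) = r := by
  rw [below_eq_card_filter]
  have : {x ∈ (range n).image f | x < f r} = (range r).image f := by
    ext x
    simp only [mem_filter, mem_image, mem_range]
    constructor
    · rintro ⟨⟨r', hr', rfl⟩, hlt⟩
      refine ⟨r', ?_, rfl⟩
      by_contra hle
      rcases (not_lt.1 hle).eq_or_lt with rfl | h
      · omega
      · have := hf r r' h hr'; omega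
    · rintro ⟨r', hr', rfl⟩
      exact ⟨⟨r', by omega, rfl⟩, hf r' r hr' hr⟩
  rw [this, card_image_range fun a b hab hb => hf a b hab (by omega)]

theorem nthElt_image_range (hf : ∀ r r', r < r' → r' < n → f r < f r') {r : ℕ} (hr : r < n) :
    nthElt ((range n).image f) r = f r := by
  have h := nthElt_below (mem_image_of_mem f (mem_range.2 hr))
  rwa [below_image_range hf hr] at h

end Image

theorem image_nthElt (A : Finset ℕ) : (range #A).image (nthElt A) = A := by
  ext x
  rw [mem_image]
  constructor
  · rintro ⟨r, hr, rfl⟩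
    exact nthElt_mem (mem_range.1 hr)
  · intro hx
    exact ⟨below A x, mem_range.2 (below_lt_card hx), nthElt_below hx⟩

/-! ### Fillings of skew shapes -/

/-- `t c r` is the entry of the `r`-th cell of the column `c` in a semistandard filling. -/
structure IsFilling (N W : ℕ) (a : ℕ → ℤ) (l : ℕ → ℕ) (t : ℕ → ℕ → ℕ) : Prop where
  lt : ∀ c < W, ∀ r < l c, t c r < N
  strict : ∀ c < W, ∀ r r', r < r' → r' < l c → t c r < t c r'
  row : ∀ c c', c < c' → c' < W → ∀ r < l c, ∀ r' < l c', a c + (r : ℤ) = a c' + r' →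
    t c r ≤ t c' r'

/-- The sets of entries of the columns of a filling. -/
def colSets (W : ℕ) (l : ℕ → ℕ) (t : ℕ → ℕ → ℕ) (c : ℕ) : Finset ℕ :=
  if c < W then (range (l c)).image (t c) else ∅

section Filling

variable {N W : ℕ} {a : ℕ → ℤ} {l : ℕ → ℕ} {t : ℕ → ℕ → ℕ} {A : ℕ → Finset ℕ}

theorem colSets_of_lt {c : ℕ} (hc : c < W) : colSets W l t c = (range (l c)).image (t c) := if_pos hc

theorem IsFilling.nthElt_colSets (h : IsFilling N W a l t) {c r : ℕ} (hc : c < W) (hr : r < l c) :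
    nthElt (colSets W l t c) r = t c r := by
  rw [colSets_of_lt hc, nthElt_image_range (h.strict c hc) hr]

theorem IsFilling.card_colSets (h : IsFilling N W a l t) {c : ℕ} (hc : c < W) :
    #(colSets W l t c) = l c := by
  rw [colSets_of_lt hc, card_image_range (h.strict c hc)]

theorem IsFilling.isColTableau (h : IsFilling N W a l t)
    (ha : ∀ c, c + 1 < W → a (c + 1) ≤ a c)
    (hb : ∀ c, c + 1 < W → a (c + 1) + l (c + 1) ≤ a c + l c) :
    IsColTableau N W a l (colSets W l t) where
  subset c x hx := by
    unfold colSets at hx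
    split_ifs at hx with hc
    · obtain ⟨r, hr, rfl⟩ := mem_image.1 hx
      exact mem_range.2 (h.lt c hc r (mem_range.1 hr))
    · simp at hx
  eq_empty c hc := if_neg (by omega)
  card_eq c hc := h.card_colSets hc
  row c hc := by
    refine (forall_nthElt_le_iff (ha c hc) ?_).1 ?_
    · rw [h.card_colSets hc, h.card_colSets (by omega)]
      exact hb c hc
    · intro r hr r' hr' hrr
      rw [h.card_colSets (by omega)] at hr
      rw [h.card_colSets hc] at hr'
      rw [h.nthElt_colSets (by omega) hr, h.nthElt_colSets hc hr']
      exact h.row c (c + 1) (by omega) hc r hr r' hr' hrr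

theorem IsColTableau.isFilling (h : IsColTableau N W a l A)
    (ha : ∀ c, c + 1 < W → a (c + 1) ≤ a c)
    (hb : ∀ c, c + 1 < W → a (c + 1) + l (c + 1) ≤ a c + l c) :
    IsFilling N W a l fun c => nthElt (A c) where
  lt c hc r hr := by
    rw [← h.card_eq c hc] at hr
    exact mem_range.1 (h.subset c (nthElt_mem hr))
  strict c hc r r' hr hr' := nthElt_lt_nthElt hr (by rwa [h.card_eq c hc])
  row c c' hcc hc' r hr r' hr' := by
    have hmono : a c' ≤ a c ∧ a c' + l c' ≤ a c + l c := by
      clear hr hr'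
      induction c', hcc using Nat.le_induction with
      | base => exact ⟨ha c hc', hb c hc'⟩
      | succ c' _ ih =>
        have := ih (by omega)
        have := ha c' hc'
        have := hb c' hc'
        omega
    rw [← h.card_eq c (by omega)] at hr
    rw [← h.card_eq c' hc'] at hr'
    refine (forall_nthElt_le_iff hmono.1 ?_).2 (h.row_le hcc.le hc') r hr r' hr'
    rw [h.card_eq c (by omega), h.card_eq c' hc']
    exact hmono.2

theorem IsColTableau.colSets_nthElt (h : IsColTableau N W a l A) :
    colSets W l (fun c => nthElt (A c)) = A := by
  funext c
  by_cases hc : c < W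
  · rw [colSets_of_lt hc, ← h.card_eq c hc, image_nthElt]
  · rw [h.eq_empty c (by omega), colSets, if_neg hc]

theorem IsFilling.weightFrom_colSets (h : IsFilling N W a l t) (x : ℕ) :
    weightFrom W (colSets W l t) 0 x = ∑ c ∈ range W, #{r ∈ range (l c) | t c r = x} := by
  unfold weightFrom
  rw [card_filter, Nat.Ico_zero_eq_range]
  refine sum_congr rfl fun c hc => ?_
  rw [mem_range] at hc
  rw [colSets_of_lt hc]
  split_ifs with hx
  · obtain ⟨r, hr, rfl⟩ := mem_image.1 hx
    rw [mem_range] at hr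
    symm
    rw [card_eq_one]
    refine ⟨r, ?_⟩
    ext r'
    rw [mem_filter, mem_range, mem_singleton]
    constructor
    · rintro ⟨hr', h1⟩
      rcases lt_trichotomy r r' with h2 | h2 | h2
      · have := h.strict c hc r r' h2 hr'; omega
      · exact h2.symm
      · have := h.strict c hc r' r h2 hr; omega
    · rintro rfl
      exact ⟨hr, rfl⟩
  · symm
    rw [card_eq_zero, filter_eq_empty_iff]
    exact fun r hr h => hx (mem_image.2 ⟨r, hr, h⟩)

end Filling

/-! ### The alternating functional on power series -/

open Classical in
/-- The coefficient of the Schur polynomial of `ν`, as a linear functional of the coefficients of a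
symmetric polynomial. -/
noncomputable def altCoeff (N : ℕ) (ν : ℕ → ℕ) : MvPowerSeries (Fin N) ℚ →ₗ[ℚ] ℚ :=
  ∑ w : Equiv.Perm (Fin N), ((Equiv.Perm.sign w : ℤ) : ℚ) •
    if ∀ i : Fin N, 0 ≤ (ν (w i) : ℤ) - (w i : ℕ) + (i : ℕ) then
      MvPowerSeries.coeff (Finsupp.equivFunOnFinite.symm fun i : Fin N =>
        ((ν (w i) : ℤ) - (w i : ℕ) + (i : ℕ)).toNat)
    else 0

/-- Exchange the sum over permutations with the sum over tableaux. Permutations that would need a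
negative exponent are discarded in `altCoeff`, and no weight matches them in `altSum`. -/
theorem altCoeff_eq_sum {N : ℕ} {ν : ℕ → ℕ} {g : MvPowerSeries (Fin N) ℚ} {α : Type*}
    {X : Finset α} {wt : α → ℕ → ℕ}
    (h : ∀ m : Fin N →₀ ℕ, MvPowerSeries.coeff m g = #{x ∈ X | ∀ i : Fin N, wt x i = m i}) :
    altCoeff N ν g = ((∑ x ∈ X, altSum N ν (wt x) : ℤ) : ℚ) := by
  unfold altCoeff altSum
  rw [sum_comm, LinearMap.sum_apply, Int.cast_sum]
  refine sum_congr rfl fun w _ => ?_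
  rw [LinearMap.smul_apply, ← mul_sum, Int.cast_mul, smul_eq_mul]
  congr 1
  rw [sum_boole, Int.cast_natCast]
  split_ifs with hw
  · rw [h]
    congr 2
    refine filter_congr fun x _ => forall_congr' fun i => ?_
    have := hw i
    rw [Finsupp.equivFunOnFinite_symm_apply_apply]
    omega
  · rw [LinearMap.zero_apply, filter_false_of_mem, card_empty, Nat.cast_zero]
    intro x _ hx
    exact hw fun i => by have := hx i; omega

theorem coeff_specializeVars (N : ℕ) (f : MvPowerSeries ℕ ℚ) (m : Fin N →₀ ℕ) :
    MvPowerSeries.coeff m (specializeVars N f) = f (m.mapDomain fun i : Fin N => (i : ℕ)) := rfl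

/-! ### Schur functions of partitions -/

theorem mapDomain_fin_eq_iff {N : ℕ} (m : Fin N →₀ ℕ) (v : ℕ →₀ ℕ) :
    v = m.mapDomain (fun i : Fin N => (i : ℕ)) ↔
      (∀ i : Fin N, v i = m i) ∧ ∀ x, N ≤ x → v x = 0 := by
  have hinj : Function.Injective (fun i : Fin N => (i : ℕ)) := Fin.val_injective
  have hout : ∀ x, N ≤ x → m.mapDomain (fun i : Fin N => (i : ℕ)) x = 0 := by
    intro x hx
    refine Finsupp.mapDomain_of_notMem_range m x ?_
    rintro ⟨i, rfl⟩
    have := i.2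
    simp only at hx
    omega
  constructor
  · rintro rfl
    exact ⟨fun i => Finsupp.mapDomain_apply hinj m i, hout⟩
  · rintro ⟨h1, h2⟩
    ext x
    by_cases hx : x < N
    · rw [show x = ((⟨x, hx⟩ : Fin N) : ℕ) from rfl, h1 ⟨x, hx⟩]
      exact (Finsupp.mapDomain_apply hinj m ⟨x, hx⟩).symm
    · rw [h2 x (by omega), hout x (by omega)]

/-- Counting tableaux of a given content through their sets of entries. -/
theorem natCard_content_eq {N W : ℕ} {α : Type*} {F : α → ℕ → Finset ℕ}
    {X : Finset (ℕ → Finset ℕ)} {v : α → ℕ →₀ ℕ}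
    (hF : ∀ T, (∀ x, N ≤ x → v T x = 0) → F T ∈ X ∧ ∀ x, weightFrom W (F T) 0 x = v T x)
    (hinj : ∀ T T', (∀ x, N ≤ x → v T x = 0) → (∀ x, N ≤ x → v T' x = 0) → F T = F T' → T = T')
    (hsurj : ∀ A ∈ X, ∃ T, F T = A ∧ ∀ x, N ≤ x → v T x = 0) (m : Fin N →₀ ℕ) :
    Nat.card {T : α // v T = m.mapDomain fun i : Fin N => (i : ℕ)} =
      #{A ∈ X | ∀ i : Fin N, weightFrom W A 0 i = m i} := by
  rw [← Fintype.card_coe, ← Nat.card_eq_fintype_card]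
  refine Nat.card_congr (Equiv.ofBijective (fun T => ⟨F T.1, ?_⟩) ⟨?_, ?_⟩)
  · have h := (mapDomain_fin_eq_iff m _).1 T.2
    have h' := hF T.1 h.2
    exact mem_filter.2 ⟨h'.1, fun i => by rw [h'.2, h.1]⟩
  · rintro ⟨T, hT⟩ ⟨T', hT'⟩ h
    exact Subtype.ext (hinj T T' ((mapDomain_fin_eq_iff m _).1 hT).2
      ((mapDomain_fin_eq_iff m _).1 hT').2 (congrArg Subtype.val h))
  · rintro ⟨A, hA⟩
    rw [mem_filter] at hA
    obtain ⟨T, rfl, hT⟩ := hsurj A hA.1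
    exact ⟨⟨T, (mapDomain_fin_eq_iff m _).2 ⟨fun i => by rw [← (hF T hT).2, hA.2 i], hT⟩⟩, rfl⟩

theorem ssytContent_apply {nu : YoungDiagram} (T : SemistandardYoungTableau nu) (x : ℕ) :
    ssytContent T x = ∑ c ∈ range (nu.rowLen 0), #{r ∈ range (nu.colLen c) | T r c = x} := by
  have h1 : ssytContent T x = ∑ p ∈ nu.cells, if T p.1 p.2 = x then 1 else 0 := by
    unfold ssytContent
    rw [Finsupp.finsetSum_apply]
    exact sum_congr rfl fun p _ => Finsupp.single_apply
  simp only [h1, card_filter, sum_sigma']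
  refine sum_nbij' (fun p => ⟨p.2, p.1⟩) (fun p => (p.2, p.1)) ?_ ?_ (fun _ _ => rfl)
    (fun _ _ => rfl) (fun _ _ => rfl)
  · rintro ⟨i, j⟩ h
    rw [YoungDiagram.mem_cells] at h
    rw [mem_sigma, mem_range, mem_range]
    exact ⟨YoungDiagram.mem_iff_lt_rowLen.1 (nu.up_left_mem (Nat.zero_le _) le_rfl h),
      YoungDiagram.mem_iff_lt_colLen.1 h⟩
  · rintro ⟨j, i⟩ h
    rw [mem_sigma, mem_range, mem_range] at h
    exact YoungDiagram.mem_iff_lt_colLen.2 h.2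

section Schur

variable {N : ℕ} (nu : YoungDiagram)

theorem isFilling_of_ssyt (T : SemistandardYoungTableau nu)
    (hT : ∀ x, N ≤ x → ssytContent T x = 0) :
    IsFilling N (nu.rowLen 0) (fun _ => 0) nu.colLen fun c r => T r c where
  lt c hc r hr := by
    by_contra hlt
    have := hT (T r c) (by omega)
    rw [ssytContent_apply, sum_eq_zero_iff] at this
    have := this c (mem_range.2 hc)
    rw [card_eq_zero, filter_eq_empty_iff] at this
    exact this (mem_range.2 hr) rfl
  strict c _ r r' hr hr' := T.col_strict hr (YoungDiagram.mem_iff_lt_colLen.2 hr')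
  row c c' hc _ r _ r' hr' h := by
    obtain rfl : r = r' := by omega
    exact T.row_weak hc (YoungDiagram.mem_iff_lt_colLen.2 hr')

theorem colLen_succ_le (c : ℕ) : nu.colLen (c + 1) ≤ nu.colLen c :=
  nu.colLen_anti _ _ (Nat.le_succ c)

theorem coeff_schurFunction (m : Fin N →₀ ℕ) :
    MvPowerSeries.coeff m (specializeVars N (schurFunction nu)) =
      #{A ∈ colTableaux N (nu.rowLen 0) (fun _ => 0) nu.colLen |
        ∀ i : Fin N, weightFrom (nu.rowLen 0) A 0 i = m i} := by
  rw [coeff_specializeVars]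
  unfold schurFunction
  congr 1
  have hb : ∀ c, c + 1 < nu.rowLen 0 → (0 : ℤ) + nu.colLen (c + 1) ≤ 0 + nu.colLen c := fun c _ => by
    have := colLen_succ_le nu c
    omega
  refine natCard_content_eq (v := ssytContent)
    (F := fun T => colSets (nu.rowLen 0) nu.colLen fun c r => T r c) ?_ ?_ ?_ m
  · intro T hT
    have h := isFilling_of_ssyt nu T hT
    refine ⟨mem_colTableaux.2 (h.isColTableau (fun _ _ => le_rfl) hb), fun x => ?_⟩
    rw [h.weightFrom_colSets, ssytContent_apply]
  · intro T T' hT hT' h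
    ext r c
    by_cases hrc : (r, c) ∈ nu
    · have hc : c < nu.rowLen 0 :=
        YoungDiagram.mem_iff_lt_rowLen.1 (nu.up_left_mem (Nat.zero_le _) le_rfl hrc)
      have hr := YoungDiagram.mem_iff_lt_colLen.1 hrc
      rw [← (isFilling_of_ssyt nu T hT).nthElt_colSets hc hr,
        ← (isFilling_of_ssyt nu T' hT').nthElt_colSets hc hr]
      exact congrArg (fun A : ℕ → Finset ℕ => nthElt (A c) r) h
    · rw [T.zeros hrc, T'.zeros hrc]
  · intro A hA
    rw [mem_colTableaux] at hA
    have hf := hA.isFilling (fun _ _ => le_rfl) hb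
    have hmem : ∀ {r c}, (r, c) ∈ nu → c < nu.rowLen 0 ∧ r < nu.colLen c := fun h =>
      ⟨YoungDiagram.mem_iff_lt_rowLen.1 (nu.up_left_mem (Nat.zero_le _) le_rfl h),
        YoungDiagram.mem_iff_lt_colLen.1 h⟩
    classical
    let T : SemistandardYoungTableau nu :=
      { entry := fun r c => if (r, c) ∈ nu then nthElt (A c) r else 0
        row_weak' := fun {i j1 j2} hj h => by
          have h' := nu.up_left_mem le_rfl hj.le h
          rw [if_pos h, if_pos h']
          exact hf.row j1 j2 hj (hmem h).1 i (hmem h').2 i (hmem h).2 rfl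
        col_strict' := fun {i1 i2 j} hi h => by
          rw [if_pos h, if_pos (nu.up_left_mem hi.le le_rfl h)]
          exact hf.strict j (hmem h).1 i1 i2 hi (hmem h).2
        zeros' := fun h => if_neg h }
    have hT : ∀ c r, r < nu.colLen c → T r c = nthElt (A c) r := fun c r hr =>
      if_pos (YoungDiagram.mem_iff_lt_colLen.2 hr)
    refine ⟨T, ?_, ?_⟩
    · rw [← hA.colSets_nthElt]
      funext c
      unfold colSets
      split_ifs with hc
      · exact image_congr fun r hr => hT c r (mem_range.1 hr)
      · rfl
    · intro x hx
      rw [ssytContent_apply]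
      refine sum_eq_zero fun c hc => ?_
      rw [card_eq_zero, filter_eq_empty_iff]
      intro r hr h
      have := hf.lt c (mem_range.1 hc) r (mem_range.1 hr)
      rw [hT c r (mem_range.1 hr)] at h
      omega

theorem altCoeff_schurFunction_nonneg {ν : ℕ → ℕ} (hν : Antitone ν) :
    0 ≤ altCoeff N ν (specializeVars N (schurFunction nu)) := by
  rw [altCoeff_eq_sum (coeff_schurFunction nu)]
  exact_mod_cast sum_altSum_nonneg N _ _ _ hν

/-- Linearity reduces this to Schur polynomials. Only non-negativity on each of them is used, not
that the functional isolates a single coefficient. -/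
theorem altCoeff_nonneg_of_schurPositive {ν : ℕ → ℕ} (hν : Antitone ν) {f : MvPowerSeries ℕ ℚ}
    (hf : SchurPositiveInVars N f) : 0 ≤ altCoeff N ν (specializeVars N f) := by
  obtain ⟨c, hc, -, h⟩ := hf
  rw [h, map_finsuppSum]
  refine Finsupp.sum_nonneg fun nu _ => ?_
  rw [map_smul, smul_eq_mul]
  exact mul_nonneg (hc nu) (altCoeff_schurFunction_nonneg nu hν)

end Schur

/-! ### Cylindric shapes that are not skew shapes -/

namespace Cylinder

variable {v u : ℕ}

theorem mk_shift (i j t : ℤ) : mk v u (i - t * u) (j + t * v) = mk v u i j :=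
  (mk_eq_mk_iff.2 ⟨t, rfl, rfl⟩).symm

theorem mk_le_mk {i j i' j' : ℤ} (h : i ≤ i') (h' : j ≤ j') : mk v u i j ≤ mk v u i' j' :=
  ⟨i, j, i', j', rfl, rfl, h, h'⟩

theorem exists_mk_window (hu : 0 < u) (q : ℤ) (c : Cylinder v u) :
    ∃ p : ℤ × ℤ, c = mk v u p.1 p.2 ∧ q < p.1 ∧ p.1 ≤ q + u := by
  obtain ⟨⟨i, j⟩, rfl⟩ := QuotientAddGroup.mk_surjective c
  have hu' : (0 : ℤ) < u := by exact_mod_cast hu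
  refine ⟨(i - (i - q - 1) / u * u, j + (i - q - 1) / u * v), (mk_shift i j _).symm, ?_, ?_⟩
  · have := Int.emod_add_mul_ediv (i - q - 1) u
    have := Int.emod_nonneg (i - q - 1) hu'.ne'
    have := mul_comm ((i - q - 1) / u) (u : ℤ)
    simp only
    omega
  · have := Int.emod_add_mul_ediv (i - q - 1) u
    have := Int.emod_lt_of_pos (i - q - 1) hu'
    have := mul_comm ((i - q - 1) / u) (u : ℤ)
    simp only
    omega

theorem eq_of_mk_eq_of_lt {q i j i' j' : ℤ} (h : mk v u i j = mk v u i' j')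
    (h1 : q < i) (h2 : i ≤ q + u) (h3 : q < i') (h4 : i' ≤ q + u) : i = i' ∧ j = j' := by
  obtain ⟨t, rfl, rfl⟩ := mk_eq_mk_iff.1 h
  have : t = 0 := by
    rcases lt_trichotomy t 0 with ht | ht | ht
    · have : (u : ℤ) ≤ -t * u := by nlinarith
      nlinarith
    · exact ht
    · have : (u : ℤ) ≤ t * u := by nlinarith
      nlinarith
  subst this
  simp

theorem mk_injective (hu : 0 < u) (q : ℤ) : Function.Injective (mk v u q) := fun j j' h =>
  (eq_of_mk_eq_of_lt (q := q - 1) h (by omega) (by omega) (by omega) (by omega)).2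

end Cylinder

/-- The skew shape spanned by a finite set of boxes. -/
theorem exists_youngDiagrams (P : Finset (ℕ × ℕ)) : ∃ lam mu : YoungDiagram, mu ≤ lam ∧
    ∀ p : ℕ × ℕ, (p ∈ lam ∧ p ∉ mu) ↔ (∃ p' ∈ P, p ≤ p') ∧ ∃ p' ∈ P, p' ≤ p := by
  classical
  have hmem : ∀ p, p ∈ P.biUnion Finset.Iic ↔ ∃ p' ∈ P, p ≤ p' := by simp
  let lam : YoungDiagram := ⟨P.biUnion Finset.Iic, by
    intro p p' hle hp
    rw [mem_coe, hmem] at hp ⊢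
    obtain ⟨x, hx, hpx⟩ := hp
    exact ⟨x, hx, hle.trans hpx⟩⟩
  let mu : YoungDiagram := ⟨{p ∈ P.biUnion Finset.Iic | ¬ ∃ p' ∈ P, p' ≤ p}, by
    intro p p' hle hp
    rw [mem_coe, mem_filter, hmem] at hp ⊢
    obtain ⟨⟨x, hx, hpx⟩, h⟩ := hp
    exact ⟨⟨x, hx, hle.trans hpx⟩, fun ⟨y, hy, hyp⟩ => h ⟨y, hy, hyp.trans hle⟩⟩⟩
  refine ⟨lam, mu, filter_subset _ _, fun p => ?_⟩
  have h1 : p ∈ lam ↔ ∃ p' ∈ P, p ≤ p' := hmem p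
  have h2 : p ∈ mu ↔ (∃ p' ∈ P, p ≤ p') ∧ ¬ ∃ p' ∈ P, p' ≤ p := by
    rw [← hmem p]
    exact mem_filter
  rw [h1, h2, not_and_not_right]
  exact and_congr_right fun h => forall_prop_of_true h

namespace CylindricSkewShape

variable {v u : ℕ} (C : CylindricSkewShape v u)

theorem mk_mem_of_le {i j i' j' x y : ℤ} (h : Cylinder.mk v u i j ∈ C.cells)
    (h' : Cylinder.mk v u i' j' ∈ C.cells) (h1 : i ≤ x) (h2 : x ≤ i') (h3 : j ≤ y) (h4 : y ≤ j') :
    Cylinder.mk v u x y ∈ C.cells :=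
  C.convex.out (mem_coe.2 h) (mem_coe.2 h') ⟨Cylinder.mk_le_mk h1 h3, Cylinder.mk_le_mk h2 h4⟩

/-- A cylindric shape that can be cut between two columns is a skew shape. -/
theorem isIsoToSkewShape_of_cut (hu : 0 < u) (q : ℤ)
    (hq : ∀ j, Cylinder.mk v u q j ∈ C.cells → Cylinder.mk v u (q + 1) j ∉ C.cells) :
    C.IsIsoToSkewShape := by
  classical
  -- Unroll the cylinder at the cut: representatives are taken in the `u` columns after `q`.
  choose X hX1 hX2 hX3 using fun c : Cylinder v u => Cylinder.exists_mk_window hu q c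
  have hle : ∀ c ∈ C.cells, ∀ c' ∈ C.cells,
      (c ≤ c' ↔ (X c).1 ≤ (X c').1 ∧ (X c).2 ≤ (X c').2) := by
    intro c hc c' hc'
    constructor
    · rintro ⟨i, j, i', j', h1, h2, h3, h4⟩
      obtain ⟨t, rfl, rfl⟩ := Cylinder.mk_eq_mk_iff.1 ((hX1 c).symm.trans h1)
      obtain ⟨t', rfl, rfl⟩ := Cylinder.mk_eq_mk_iff.1 ((hX1 c').symm.trans h2)
      have b1 := hX2 c
      have b2 := hX3 c
      have b3 := hX2 c'
      have b4 := hX3 c'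
      rcases lt_trichotomy t t' with ht | rfl | ht
      · have : (u : ℤ) ≤ (t' - t) * u := by nlinarith
        nlinarith
      · exact ⟨by linarith, by linarith⟩
      -- Here the relation runs to the right past the cut. By convexity the row of `c` then has
      -- cells in both columns adjacent to the cut, contrary to `hq`.
      · exfalso
        have hs : (u : ℤ) ≤ (t - t') * u := by nlinarith
        have h5 : Cylinder.mk v u ((X c').1 - (t' - t) * u) ((X c').2 + (t' - t) * v) ∈ C.cells := by
          rw [Cylinder.mk_shift, ← hX1]
          exact hc'
        have h6 : Cylinder.mk v u (X c).1 (X c).2 ∈ C.cells := by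
          rw [← hX1]
          exact hc
        have h7 := C.mk_mem_of_le h6 h5 (x := q + u) (y := (X c).2) b2 (by linarith) le_rfl
          (by linarith)
        have h8 := C.mk_mem_of_le h6 h5 (x := q + 1 + u) (y := (X c).2) (by linarith)
          (by linarith) le_rfl (by linarith)
        rw [← Cylinder.mk_shift _ _ 1] at h7 h8
        refine hq ((X c).2 + 1 * v) ?_ ?_
        · convert h7 using 2; ring
        · convert h8 using 2; ring
    · rintro ⟨h1, h2⟩
      rw [hX1 c, hX1 c']
      exact Cylinder.mk_le_mk h1 h2
  obtain ⟨y0, hy0⟩ : ∃ y0 : ℤ, ∀ c ∈ C.cells, y0 ≤ (X c).2 := by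
    obtain ⟨y0, hy0⟩ := (C.cells.image fun c => (X c).2).bddBelow
    exact ⟨y0, fun c hc => hy0 (mem_coe.2 (mem_image_of_mem _ hc))⟩
  let pos : {c // c ∈ C.cells} → ℕ × ℕ := fun c =>
    (((X c.1).2 - y0).toNat, ((X c.1).1 - q - 1).toNat)
  have hpos : ∀ c : {c // c ∈ C.cells}, ((pos c).1 : ℤ) = (X c.1).2 - y0 ∧
      ((pos c).2 : ℤ) = (X c.1).1 - q - 1 := by
    intro c
    have := hy0 c.1 c.2
    have := hX2 c.1
    simp only [pos]
    omega
  have hposle : ∀ c c', c ≤ c' ↔ pos c ≤ pos c' := by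
    intro c c'
    rw [← Subtype.coe_le_coe, hle c.1 c.2 c'.1 c'.2, Prod.le_def]
    have := hpos c
    have := hpos c'
    omega
  have hwin : ∀ c c' : {c // c ∈ C.cells}, ∀ i j : ℤ, c'.1 = Cylinder.mk v u i j →
      i = (X c.1).1 → (X c'.1).1 = i ∧ (X c'.1).2 = j := by
    intro c c' i j h hi
    have h1 := hX2 c.1
    have h2 := hX3 c.1
    exact Cylinder.eq_of_mk_eq_of_lt ((hX1 c'.1).symm.trans h) (hX2 _) (hX3 _) (by omega) (by omega)
  obtain ⟨lam, mu, hmulam, hlm⟩ := exists_youngDiagrams (univ.image pos)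
  have hexists : ∀ p : ℕ × ℕ, (p ∈ lam ∧ p ∉ mu) ↔ ∃ c, pos c = p := by
    intro p
    rw [hlm]
    simp only [mem_image, mem_univ, true_and, exists_exists_eq_and]
    constructor
    · rintro ⟨⟨c2, h2⟩, ⟨c1, h1⟩⟩
      have e1 := hpos c1
      have e2 := hpos c2
      rw [Prod.le_def] at h1 h2
      have h6 : Cylinder.mk v u (X c1.1).1 (X c1.1).2 ∈ C.cells := by
        rw [← hX1]
        exact c1.2
      have h7 : Cylinder.mk v u (X c2.1).1 (X c2.1).2 ∈ C.cells := by
        rw [← hX1]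
        exact c2.2
      have h8 := C.mk_mem_of_le h6 h7 (x := p.2 + q + 1) (y := p.1 + y0) (by omega) (by omega)
        (by omega) (by omega)
      have b1 := hX2 c1.1
      have b2 := hX3 c2.1
      have h9 := Cylinder.eq_of_mk_eq_of_lt (hX1 (Cylinder.mk v u (p.2 + q + 1) (p.1 + y0))).symm
        (hX2 _) (hX3 _) (q := q) (by omega) (by omega)
      refine ⟨⟨_, h8⟩, Prod.ext ?_ ?_⟩
      · have := (hpos ⟨_, h8⟩).1
        rw [h9.2] at this
        omega
      · have := (hpos ⟨_, h8⟩).2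
        rw [h9.1] at this
        omega
    · rintro ⟨c, rfl⟩
      exact ⟨⟨c, le_rfl⟩, ⟨c, le_rfl⟩⟩
  have hinj : ∀ c c', pos c = pos c' → c = c' := by
    intro c c' h
    have e1 := hpos c
    have e2 := hpos c'
    rw [h] at e1
    refine Subtype.ext ?_
    rw [hX1 c.1, hX1 c'.1]
    congr 1 <;> omega
  let e : {c // c ∈ C.cells} ≃ SkewCells lam mu :=
    Equiv.ofBijective (fun c => ⟨pos c, (hexists _).2 ⟨c, rfl⟩⟩)
      ⟨fun c c' h => hinj c c' (congrArg Subtype.val h), fun ⟨p, hp⟩ => by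
        obtain ⟨c, hc⟩ := (hexists p).1 hp
        exact ⟨c, Subtype.ext hc⟩⟩
  refine ⟨lam, mu, hmulam, ⟨e, fun {c c'} => (hposle c c').symm⟩, fun c c' _ => ?_⟩
  change C.StrictEdge c c' ↔ (pos c').1 = (pos c).1 + 1 ∧ (pos c').2 = (pos c).2
  have e1 := hpos c
  have e2 := hpos c'
  constructor
  · rintro ⟨i, j, h1, h2⟩
    obtain ⟨t, rfl, rfl⟩ := Cylinder.mk_eq_mk_iff.1 ((hX1 c.1).symm.trans h1)
    rw [show (X c.1).2 + t * v + 1 = (X c.1).2 + 1 + t * v by ring, Cylinder.mk_shift] at h2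
    have := hwin c c' _ _ h2 rfl
    omega
  · rintro ⟨h1, h2⟩
    refine ⟨(X c.1).1, (X c.1).2, hX1 c.1, ?_⟩
    rw [hX1 c'.1]
    congr 1 <;> omega

/-- The boundary of a cylindric shape in which consecutive columns share a row. -/
structure HasBounds (a b : ℤ → ℤ) : Prop where
  mem : ∀ q j, Cylinder.mk v u q j ∈ C.cells ↔ a q ≤ j ∧ j < b q
  top : ∀ q, a (q + 1) ≤ a q
  bot : ∀ q, b (q + 1) ≤ b q
  overlap : ∀ q, a q < b (q + 1)
  top_shift : ∀ q, a (q + u) = a q - v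
  bot_shift : ∀ q, b (q + u) = b q - v
  toric : ∀ q, b q ≤ a q + v

/-- Since no cut is possible, neighbouring columns share a row. Convexity then makes each column an
interval and lets both of its ends only move up on passing to the right. -/
theorem exists_hasBounds (hu : 0 < u) (hC : C.IsToric) (hskew : ¬ C.IsIsoToSkewShape) :
    ∃ a b, C.HasBounds a b := by
  classical
  have hover : ∀ q, ∃ j, Cylinder.mk v u q j ∈ C.cells ∧ Cylinder.mk v u (q + 1) j ∈ C.cells := by
    intro q
    by_contra hcon
    push Not at hcon
    exact hskew (C.isIsoToSkewShape_of_cut hu q hcon)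
  let S : ℤ → Finset ℤ := fun q =>
    C.cells.preimage (Cylinder.mk v u q) (Cylinder.mk_injective hu q).injOn
  have hS : ∀ q j, j ∈ S q ↔ Cylinder.mk v u q j ∈ C.cells := fun q j => mem_preimage
  have hne : ∀ q, (S q).Nonempty := fun q => by
    obtain ⟨j, hj, -⟩ := hover q
    exact ⟨j, (hS q j).2 hj⟩
  let a : ℤ → ℤ := fun q => (S q).min' (hne q)
  let b : ℤ → ℤ := fun q => (S q).max' (hne q) + 1
  have hmem : ∀ q j, Cylinder.mk v u q j ∈ C.cells ↔ a q ≤ j ∧ j < b q := by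
    intro q j
    constructor
    · intro h
      exact ⟨min'_le _ _ ((hS q j).2 h), Int.lt_add_one_iff.2 (le_max' _ _ ((hS q j).2 h))⟩
    · rintro ⟨h1, h2⟩
      exact C.mk_mem_of_le ((hS q _).1 (min'_mem _ (hne q))) ((hS q _).1 (max'_mem _ (hne q)))
        le_rfl le_rfl h1 (Int.lt_add_one_iff.1 h2)
  have hab : ∀ q, a q < b q := fun q =>
    Int.lt_add_one_iff.2 (min'_le _ _ (max'_mem _ (hne q)))
  have hshift : ∀ q j, (a (q + u) ≤ j ∧ j < b (q + u)) ↔ a q ≤ j + v ∧ j + v < b q := by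
    intro q j
    rw [← hmem, ← hmem, ← Cylinder.mk_shift (q + u) j 1]
    rw [add_sub_assoc, one_mul, sub_self, add_zero, one_mul]
  refine ⟨a, b, hmem, ?_, ?_, ?_, ?_, ?_, ?_⟩
  · intro q
    obtain ⟨j, hj, hj'⟩ := hover q
    have h1 := (hmem q j).1 hj
    exact ((hmem _ _).1 (C.mk_mem_of_le ((hmem q (a q)).2 ⟨le_rfl, hab q⟩) hj' (x := q + 1)
      (y := a q) (by omega) le_rfl le_rfl h1.1)).1
  · intro q
    obtain ⟨j, hj, hj'⟩ := hover q
    have h1 := (hmem _ j).1 hj'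
    have := ((hmem _ _).1 (C.mk_mem_of_le hj ((hmem (q + 1) (b (q + 1) - 1)).2
      ⟨by have := hab (q + 1); omega, by omega⟩) (x := q) (y := b (q + 1) - 1) le_rfl (by omega)
      (by omega) le_rfl)).2
    omega
  · intro q
    obtain ⟨j, hj, hj'⟩ := hover q
    have h1 := (hmem _ j).1 hj'
    have h2 := (hmem _ j).1 hj
    omega
  · intro q
    have h1 := hab q
    have h2 := hab (q + u)
    have h3 := (hshift q (a (q + u))).1 ⟨le_rfl, h2⟩
    have h4 := (hshift q (a q - v)).2 ⟨by omega, by omega⟩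
    omega
  · intro q
    have h1 := hab q
    have h2 := hab (q + u)
    have h3 := (hshift q (b (q + u) - 1)).1 ⟨by omega, by omega⟩
    have h4 := (hshift q (b q - 1 - v)).2 ⟨by omega, by omega⟩
    omega
  · intro q
    have h1 := hC q
    have h2 : C.column q = Cylinder.mk v u q '' (Ico (a q) (b q) : Finset ℤ) := by
      ext c
      simp only [column, Set.mem_ofPred_eq, Set.mem_image, mem_coe, mem_Ico, ← hmem]
      constructor
      · rintro ⟨hc, j, rfl⟩
        exact ⟨j, hc, rfl⟩
      · rintro ⟨j, hj, rfl⟩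
        exact ⟨hj, j, rfl⟩
    rw [h2, Set.ncard_image_of_injective _ (Cylinder.mk_injective hu q), Set.ncard_coe_finset,
      Int.card_Ico] at h1
    omega

end CylindricSkewShape

/-! ### Cylindric tableaux as wrapped column tableaux -/

namespace CylindricSkewShape

variable {v u : ℕ} {C : CylindricSkewShape v u} {a b : ℤ → ℤ} {N : ℕ}

namespace HasBounds

theorem top_shift_mul (h : C.HasBounds a b) (q t : ℤ) : a (q - t * u) = a q + t * v := by
  have key : ∀ (n : ℕ) q, a (q + n * u) = a q - n * v := by
    intro n
    induction n with
    | zero => simp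
    | succ n ih =>
      intro q
      have := h.top_shift (q + n * u)
      rw [ih] at this
      push_cast
      rw [show q + ((n : ℤ) + 1) * u = q + n * u + u by ring, this]
      ring
  obtain ⟨n, rfl | rfl⟩ := t.eq_nat_or_neg
  · have := key n (q - n * u)
    rw [sub_add_cancel] at this
    linarith
  · have := key n q
    rw [show q - -(n : ℤ) * u = q + n * u by ring, this]
    ring

theorem bot_shift_mul (h : C.HasBounds a b) (q t : ℤ) : b (q - t * u) = b q + t * v := by
  have key : ∀ (n : ℕ) q, b (q + n * u) = b q - n * v := by
    intro n
    induction n with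
    | zero => simp
    | succ n ih =>
      intro q
      have := h.bot_shift (q + n * u)
      rw [ih] at this
      push_cast
      rw [show q + ((n : ℤ) + 1) * u = q + n * u + u by ring, this]
      ring
  obtain ⟨n, rfl | rfl⟩ := t.eq_nat_or_neg
  · have := key n (q - n * u)
    rw [sub_add_cancel] at this
    linarith
  · have := key n q
    rw [show q - -(n : ℤ) * u = q + n * u by ring, this]
    ring

theorem lt (h : C.HasBounds a b) (q : ℤ) : a q < b q :=
  (h.overlap q).trans_le (h.bot q)

/-- Every cell has a representative in the `u` columns starting from `q`. -/
theorem exists_cell (h : C.HasBounds a b) (hu : 0 < u) (q : ℤ) {x : Cylinder v u}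
    (hx : x ∈ C.cells) : ∃ c < u, ∃ r < (b (q + c) - a (q + c)).toNat,
      x = Cylinder.mk v u (q + (c : ℕ)) (a (q + (c : ℕ)) + (r : ℕ)) := by
  obtain ⟨⟨i, j⟩, rfl, h1, h2⟩ := Cylinder.exists_mk_window hu (q - 1) x
  simp only at h1 h2 hx ⊢
  have h3 := (h.mem i j).1 hx
  refine ⟨(i - q).toNat, by omega, (j - a i).toNat, ?_, ?_⟩
  · rw [show q + ((i - q).toNat : ℤ) = i by omega]
    omega
  · rw [show q + ((i - q).toNat : ℤ) = i by omega, show a i + ((j - a i).toNat : ℤ) = j by omega]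

end HasBounds

open Classical in
/-- The entry of a tableau at a point of the cylinder, `0` outside the shape. -/
noncomputable def Tableau.val (T : C.Tableau) (x : Cylinder v u) : ℕ :=
  if h : x ∈ C.cells then T.entry ⟨x, h⟩ else 0

theorem Tableau.val_of_mem (T : C.Tableau) {x : Cylinder v u} (h : x ∈ C.cells) :
    T.val x = T.entry ⟨x, h⟩ := dif_pos h

theorem Tableau.content_apply (h : C.HasBounds a b) (hu : 0 < u) (q : ℤ) (T : C.Tableau) (x : ℕ) :
    T.content x = ∑ c ∈ range u, #{r ∈ range (b (q + c) - a (q + c)).toNat |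
      T.val (Cylinder.mk v u (q + (c : ℕ)) (a (q + (c : ℕ)) + (r : ℕ))) = x} := by
  have h1 : T.content x = ∑ y ∈ C.cells, if T.val y = x then 1 else 0 := by
    unfold Tableau.content
    rw [Finsupp.finsetSum_apply, ← sum_coe_sort C.cells fun y => if T.val y = x then 1 else 0]
    refine sum_congr rfl fun y _ => ?_
    rw [T.val_of_mem y.2]
    exact Finsupp.single_apply
  rw [h1]
  simp only [card_filter, sum_sigma']
  symm
  refine sum_bij (fun p _ => Cylinder.mk v u (q + (p.1 : ℕ)) (a (q + (p.1 : ℕ)) + (p.2 : ℕ)))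
    ?_ ?_ ?_ (fun _ _ => rfl)
  · rintro ⟨c, r⟩ hp
    rw [mem_sigma, mem_range, mem_range] at hp
    simp only at hp ⊢
    rw [h.mem]
    omega
  · rintro ⟨c, r⟩ hp ⟨c', r'⟩ hp' heq
    rw [mem_sigma, mem_range, mem_range] at hp hp'
    simp only at hp hp' heq
    obtain ⟨e1, e2⟩ := Cylinder.eq_of_mk_eq_of_lt (q := q - 1) heq (by omega) (by omega) (by omega)
      (by omega)
    obtain rfl : c = c' := by omega
    obtain rfl : r = r' := by omega
    rfl
  · intro y hy
    obtain ⟨c, hc, r, hr, rfl⟩ := h.exists_cell hu q hy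
    exact ⟨⟨c, r⟩, by rw [mem_sigma, mem_range, mem_range]; exact ⟨hc, hr⟩, rfl⟩

section Bijection

variable (h : C.HasBounds a b) (hu : 0 < u) (q : ℤ)

include h hu

theorem Tableau.isFilling (T : C.Tableau) (hT : ∀ x, N ≤ x → T.content x = 0) :
    IsFilling N u (fun c => a (q + c)) (fun c => (b (q + c) - a (q + c)).toNat) fun c r =>
      T.val (Cylinder.mk v u (q + (c : ℕ)) (a (q + (c : ℕ)) + (r : ℕ))) where
  lt c hc r hr := by
    by_contra hlt
    have h1 := hT _ (not_lt.1 hlt)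
    rw [Tableau.content_apply h hu q, sum_eq_zero_iff] at h1
    have h2 := h1 c (mem_range.2 hc)
    rw [card_eq_zero, filter_eq_empty_iff] at h2
    exact h2 (mem_range.2 hr) rfl
  strict c _ r r' hr hr' := by
    have m1 := (h.mem (q + c) (a (q + c) + (r : ℕ))).2 (by omega)
    have m2 := (h.mem (q + c) (a (q + c) + (r' : ℕ))).2 (by omega)
    rw [T.val_of_mem m1, T.val_of_mem m2]
    exact T.col_strict _ _ _ _ _ (by omega)
  row c c' hc _ r hr r' hr' hrr := by
    have m1 := (h.mem (q + c) (a (q + c) + (r : ℕ))).2 (by omega)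
    have m2 := (h.mem (q + c') (a (q + c) + (r : ℕ))).2 (by omega)
    rw [← hrr, T.val_of_mem m1, T.val_of_mem m2]
    exact T.row_weak _ _ _ _ _ (by omega)

/-- The wrap condition is the ordinary row condition between the last chosen column and the next
one, which is the first column again, moved up by `v` rows. -/
theorem Tableau.isWrapped (T : C.Tableau) (hT : ∀ x, N ≤ x → T.content x = 0) :
    IsWrapped v u (fun c => a (q + c)) (colSets u (fun c => (b (q + c) - a (q + c)).toNat)
      fun c r => T.val (Cylinder.mk v u (q + (c : ℕ)) (a (q + (c : ℕ)) + (r : ℕ)))) := by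
  have hf := T.isFilling h hu q hT
  have t1 := h.top_shift q
  have t2 := h.bot_shift q
  have t3 := h.top (q + (u - 1 : ℕ))
  have t4 := h.bot (q + (u - 1 : ℕ))
  have l1 := h.lt q
  have l2 := h.lt (q + (u - 1 : ℕ))
  rw [show q + ((u - 1 : ℕ) : ℤ) + 1 = q + u by omega] at t3 t4
  unfold IsWrapped
  refine (forall_nthElt_le_iff ?_ ?_).1 ?_
  · simp only [Nat.cast_zero, add_zero]
    omega
  · rw [hf.card_colSets hu, hf.card_colSets (by omega)]
    simp only [Nat.cast_zero, add_zero]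
    omega
  · intro r hr r' hr' hrr
    rw [hf.card_colSets (by omega)] at hr
    rw [hf.card_colSets hu] at hr'
    rw [hf.nthElt_colSets (by omega) hr, hf.nthElt_colSets hu hr']
    simp only [Nat.cast_zero, add_zero] at hr hr' hrr ⊢
    have hsh : Cylinder.mk v u q (a q + r') =
        Cylinder.mk v u (q + u) (a (q + (u - 1 : ℕ)) + r) := by
      rw [← Cylinder.mk_shift q _ (-1)]
      congr 1
      · ring
      · linarith
    have m1 := (h.mem (q + (u - 1 : ℕ)) (a (q + (u - 1 : ℕ)) + (r : ℕ))).2 (by omega)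
    have m2 := (h.mem (q + u) (a (q + (u - 1 : ℕ)) + (r : ℕ))).2 (by omega)
    rw [hsh, T.val_of_mem m1, T.val_of_mem m2]
    exact T.row_weak _ _ _ _ _ (by omega)

/-- The column sets of a wrapped tableau, extended periodically, satisfy all row conditions. -/
theorem row_periodic {A : ℕ → Finset ℕ} {l : ℕ → ℕ}
    (hA : IsColTableau N u (fun c => a (q + c)) l A)
    (hw : IsWrapped v u (fun c => a (q + c)) A) (i : ℤ) (m : ℕ) :
    a (i + 1) + (below (A ((i + 1 - q) % u).toNat) m : ℤ) ≤
      a i + below (A ((i - q) % u).toNat) m := by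
  have hu' : (0 : ℤ) < u := by exact_mod_cast hu
  obtain ⟨c, hc, t, rfl⟩ : ∃ c : ℕ, c < u ∧ ∃ t : ℤ, i = q + c - t * u := by
    refine ⟨((i - q) % u).toNat, ?_, -((i - q) / u), ?_⟩
    · have := Int.emod_lt_of_pos (i - q) hu'
      omega
    · have h1 := Int.emod_add_mul_ediv (i - q) u
      have h2 := Int.emod_nonneg (i - q) hu'.ne'
      rw [Int.toNat_of_nonneg h2]
      linarith
  have e1 : (q + (c : ℤ) - t * u - q) % u = c := by
    rw [show q + (c : ℤ) - t * u - q = c + u * (-t) by ring, Int.add_mul_emod_self_left]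
    exact Int.emod_eq_of_lt (by omega) (by omega)
  rw [e1, Int.toNat_natCast, h.top_shift_mul]
  rcases (show c + 1 ≤ u from hc).eq_or_lt with h1 | h1
  · have e2 : (q + (c : ℤ) - t * u + 1 - q) % u = 0 := by
      rw [show q + (c : ℤ) - t * u + 1 - q = 0 + u * (1 - t) by
        have : (u : ℤ) = c + 1 := by omega
        rw [this]; ring, Int.add_mul_emod_self_left]
      rfl
    have e3 : q + (c : ℤ) - t * u + 1 = q - (t - 1) * u := by
      have : (u : ℤ) = c + 1 := by omega
      rw [this]; ring
    have := hw m
    simp only [Nat.cast_zero, add_zero] at this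
    rw [show u - 1 = c by omega] at this
    rw [e2, e3, h.top_shift_mul, Int.toNat_zero]
    linarith
  · have e2 : (q + (c : ℤ) - t * u + 1 - q) % u = (c + 1 : ℕ) := by
      rw [show q + (c : ℤ) - t * u + 1 - q = (c + 1 : ℕ) + u * (-t) by push_cast; ring,
        Int.add_mul_emod_self_left]
      exact Int.emod_eq_of_lt (by omega) (by omega)
    have e3 : q + (c : ℤ) - t * u + 1 = q + (c + 1 : ℕ) - t * u := by push_cast; ring
    have := hA.row c h1 m
    rw [e2, e3, h.top_shift_mul, Int.toNat_natCast]
    linarith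

/-- Every wrapped column tableau comes from a cylindric tableau. -/
theorem exists_tableau {A : ℕ → Finset ℕ}
    (hA : IsColTableau N u (fun c => a (q + c)) (fun c => (b (q + c) - a (q + c)).toNat) A)
    (hw : IsWrapped v u (fun c => a (q + c)) A) :
    ∃ T : C.Tableau, ∀ c < u, ∀ r < (b (q + c) - a (q + c)).toNat,
      T.val (Cylinder.mk v u (q + (c : ℕ)) (a (q + (c : ℕ)) + (r : ℕ))) = nthElt (A c) r := by
  have hu' : (0 : ℤ) < u := by exact_mod_cast hu
  let A' : ℤ → Finset ℕ := fun i => A ((i - q) % u).toNat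
  have hcard : ∀ i, (#(A' i) : ℤ) = b i - a i := by
    intro i
    have h1 := Int.emod_add_mul_ediv (i - q) u
    have h2 := Int.emod_nonneg (i - q) hu'.ne'
    have h3 := Int.emod_lt_of_pos (i - q) hu'
    have h4 := hA.card_eq ((i - q) % u).toNat (by omega)
    simp only [A', h4, Int.toNat_of_nonneg h2]
    rw [show q + (i - q) % u = i - (i - q) / u * u by linarith, h.top_shift_mul, h.bot_shift_mul]
    have := h.lt i
    omega
  -- The filling on the plane, invariant under translation by (-u, v), so that it descends to the
  -- cylinder.
  let E : ℤ → ℤ → ℕ := fun i j => nthElt (A' i) (j - a i).toNat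
  have hE : ∀ i j t : ℤ, E (i - t * u) (j + t * v) = E i j := by
    intro i j t
    simp only [E, A']
    rw [h.top_shift_mul, show i - t * u - q = i - q + u * (-t) by ring, Int.add_mul_emod_self_left,
      show j + t * v - (a i + t * v) = j - a i by ring]
  have hstep : ∀ i j, a i ≤ j → j < b (i + 1) → E i j ≤ E (i + 1) j := by
    intro i j h1 h2
    have b1 := h.top i
    have b2 := h.bot i
    refine (forall_nthElt_le_iff (A := A' i) (B := A' (i + 1)) (x := a i) (y := a (i + 1)) b1 ?_).2
      (row_periodic h hu q hA hw i) _ ?_ _ ?_ ?_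
    · rw [hcard, hcard]; omega
    · have := hcard i; omega
    · have := hcard (i + 1); omega
    · omega
  have hrow : ∀ (n : ℕ) (i j : ℤ), a i ≤ j → j < b (i + n) → E i j ≤ E (i + n) j := by
    intro n
    induction n with
    | zero => simp
    | succ n ih =>
      intro i j h1 h2
      push_cast at h2 ⊢
      rw [← add_assoc] at h2 ⊢
      have h3 : a (i + n) ≤ a i := by
        clear h2 ih
        induction n with
        | zero => simp
        | succ n ih => push_cast; rw [← add_assoc]; exact (h.top _).trans ih
      exact (ih i j h1 (h2.trans_le (h.bot _))).trans (hstep _ _ (h3.trans h1) h2)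
  choose p hp using fun x : Cylinder v u => Cylinder.exists_mk_window hu q x
  have hval : ∀ i j, E (p (Cylinder.mk v u i j)).1 (p (Cylinder.mk v u i j)).2 = E i j := by
    intro i j
    obtain ⟨t, e1, e2⟩ := Cylinder.mk_eq_mk_iff.1 (hp (Cylinder.mk v u i j)).1
    rw [e1, e2, hE]
  let T : C.Tableau :=
    { entry := fun x => E (p x.1).1 (p x.1).2
      row_weak := fun i i' j m1 m2 hlt => by
        simp only [hval]
        have := hrow (i' - i).toNat i j ((h.mem _ _).1 m1).1
        rw [show i + ((i' - i).toNat : ℤ) = i' by omega] at this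
        exact this ((h.mem _ _).1 m2).2
      col_strict := fun i j j' m1 m2 hlt => by
        simp only [hval]
        have h1 := (h.mem _ _).1 m1
        have h2 := (h.mem _ _).1 m2
        have h3 := hcard i
        exact nthElt_lt_nthElt (by omega) (by omega) }
  refine ⟨T, fun c hc r hr => ?_⟩
  rw [T.val_of_mem ((h.mem _ _).2 (by omega))]
  change E _ _ = _
  rw [hval]
  simp only [E, A']
  rw [add_sub_cancel_left, add_sub_cancel_left, Int.emod_eq_of_lt (by omega) (by omega),
    Int.toNat_natCast, Int.toNat_natCast]

open Classical in
theorem coeff_schur (m : Fin N →₀ ℕ) :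
    MvPowerSeries.coeff m (specializeVars N C.schur) =
      #{A ∈ {A ∈ colTableaux N u (fun c => a (q + c)) (fun c => (b (q + c) - a (q + c)).toNat) |
          IsWrapped v u (fun c => a (q + c)) A} |
        ∀ i : Fin N, weightFrom u A 0 i = m i} := by
  rw [coeff_specializeVars]
  unfold schur
  congr 1
  have ht : ∀ c : ℕ, c + 1 < u → a (q + (c + 1 : ℕ)) ≤ a (q + c) := fun c _ => by
    have := h.top (q + c)
    rwa [add_assoc] at this
  have hb : ∀ c : ℕ, c + 1 < u → a (q + (c + 1 : ℕ)) +
      ((b (q + (c + 1 : ℕ)) - a (q + (c + 1 : ℕ))).toNat : ℤ) ≤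
        a (q + c) + (b (q + c) - a (q + c)).toNat := fun c _ => by
    have h1 := h.bot (q + c)
    have h2 := h.lt (q + c)
    have h3 := h.lt (q + (c + 1 : ℕ))
    rw [show q + (c : ℤ) + 1 = q + (c + 1 : ℕ) by push_cast; ring] at h1
    omega
  refine natCard_content_eq (v := Tableau.content)
    (F := fun T => colSets u (fun c => (b (q + c) - a (q + c)).toNat)
      fun c r => T.val (Cylinder.mk v u (q + (c : ℕ)) (a (q + (c : ℕ)) + (r : ℕ)))) ?_ ?_ ?_ m
  · intro T hT
    have hf := T.isFilling h hu q hT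
    refine ⟨mem_filter.2 ⟨mem_colTableaux.2 (hf.isColTableau ht hb), T.isWrapped h hu q hT⟩,
      fun x => ?_⟩
    rw [hf.weightFrom_colSets, Tableau.content_apply h hu q]
  · intro T T' hT hT' heq
    have hval : ∀ x ∈ C.cells, T.val x = T'.val x := by
      intro x hx
      obtain ⟨c, hc, r, hr, rfl⟩ := h.exists_cell hu q hx
      have e1 := (T.isFilling h hu q hT).nthElt_colSets hc hr
      have e2 := (T'.isFilling h hu q hT').nthElt_colSets hc hr
      rw [← e1, ← e2]
      exact congrArg (fun A : ℕ → Finset ℕ => nthElt (A c) r) heq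
    have : T.entry = T'.entry := by
      funext x
      rw [← T.val_of_mem x.2, ← T'.val_of_mem x.2, hval x.1 x.2]
    cases T
    cases T'
    simp only at this
    subst this
    rfl
  · intro A hA
    rw [mem_filter, mem_colTableaux] at hA
    obtain ⟨hA, hw⟩ := hA
    obtain ⟨T, hT⟩ := exists_tableau h hu q hA hw
    refine ⟨T, ?_, ?_⟩
    · rw [← hA.colSets_nthElt]
      funext c
      unfold colSets
      split_ifs with hc
      · exact image_congr fun r hr => hT c hc r (mem_range.1 hr)
      · rfl
    · intro x hx
      rw [Tableau.content_apply h hu q]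
      refine sum_eq_zero fun c hc => ?_
      rw [mem_range] at hc
      rw [card_eq_zero, filter_eq_empty_iff]
      intro r hr heq
      rw [mem_range] at hr
      rw [hT c hc r hr] at heq
      have := (hA.isFilling ht hb).lt c hc r hr
      omega

end Bijection

/-- The two smallest overlaps of a cylindric shape. -/
theorem HasBounds.exists_isCylProfile (h : C.HasBounds a b) (hu : 0 < u) :
    ∃ (q₀ : ℤ) (r s p q : ℕ), u = r + s + 2 ∧ q ≤ v ∧
      IsCylProfile v r s p q (fun c => a (q₀ + c)) (fun c => (b (q₀ + c) - a (q₀ + c)).toNat) := by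
  set o : ℤ → ℕ := fun i => (b (i + 1) - a i).toNat with ho
  have hov : ∀ i, (o i : ℤ) = b (i + 1) - a i := fun i => by
    have := h.overlap i
    simp only [ho]
    omega
  have hper : ∀ i, o (i + u) = o i := fun i => by
    have h1 := hov (i + u)
    have h2 := hov i
    rw [h.top_shift, show i + u + 1 = i + 1 + u by ring, h.bot_shift] at h1
    omega
  obtain ⟨i₀, hi₀⟩ : ∃ i₀, ∀ i, o i₀ ≤ o i := by
    obtain ⟨n, ⟨i₀, rfl⟩, hn⟩ := (WellFounded.has_min Nat.lt_wfRel.wf (Set.range o) ⟨_, 0, rfl⟩)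
    exact ⟨i₀, fun i => not_lt.1 (hn _ ⟨i, rfl⟩)⟩
  -- A single column sharing a row with its own copy moved by `v` rows would have more than `v`
  -- cells, which toricity excludes.
  have hu2 : 2 ≤ u := by
    by_contra hlt
    obtain rfl : u = 1 := by omega
    have h1 := h.overlap 0
    have h2 := h.bot_shift 0
    have h3 := h.toric 0
    simp at h1 h2
    omega
  obtain ⟨c, hc, hcmin⟩ := exists_min_image (range (u - 1)) (fun c : ℕ => o (i₀ + 1 + c))
    ⟨0, mem_range.2 (by omega)⟩
  rw [mem_range] at hc
  have hsucc : ∀ c : ℕ, i₀ + 1 + ((c + 1 : ℕ) : ℤ) = i₀ + 1 + c + 1 := fun c => by push_cast; ring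
  have hlt := fun c : ℕ => h.lt (i₀ + 1 + c)
  have hpos := h.overlap i₀
  have hmin := hi₀ (i₀ + 1 + c)
  have ho0 := hov i₀
  have hoc := hov (i₀ + 1 + c)
  have hlast : i₀ + 1 + ((c + (u - 2 - c) + 1 : ℕ) : ℤ) = i₀ + u := by omega
  -- Starting just after `i₀` turns the smallest overlap into the one between the last and the first
  -- column; the profile records it as `p + 1`.
  refine ⟨i₀ + 1, c, u - 2 - c, o i₀ - 1, o (i₀ + 1 + c), by omega, ?_, ?_⟩
  · have := h.toric (i₀ + 1 + c)
    have := h.bot (i₀ + 1 + c)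
    omega
  have heq : o i₀ ≤ o (i₀ + 1 + c) ∧ 0 < o i₀ := by omega
  have t1 := h.top_shift i₀
  have t2 := h.bot_shift i₀
  have t3 := h.top i₀
  have t4 := h.bot i₀
  have t5 := h.lt (i₀ + 1)
  have t6 := h.lt (i₀ + u)
  refine ⟨?_, ?_, ?_, ?_, ?_, ?_, by omega⟩
  · intro d _
    rw [hsucc]
    exact h.top _
  · intro d _
    have h1 := hlt d
    have h2 := hlt (d + 1)
    rw [hsucc] at h2 ⊢
    have h3 := h.bot (i₀ + 1 + d)
    omega
  · rw [hlast, Nat.cast_zero, add_zero]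
    omega
  · simp only [hlast, Nat.cast_zero, add_zero]
    omega
  · have h2 := hlt (c + 1)
    rw [hsucc] at h2 ⊢
    omega
  · intro d hd
    have h1 := hcmin d (mem_range.2 (by omega))
    have h2 := hlt (d + 1)
    have h3 := hov (i₀ + 1 + d)
    rw [hsucc] at h2 ⊢
    omega

end CylindricSkewShape

theorem mainTheorem7 (k n : ℕ) (hk : 1 ≤ k) (hkn : k < n)
    (C : CylindricSkewShape k (n - k)) (hC : C.IsToric) (hskew : ¬ C.IsIsoToSkewShape) :
    ¬ SchurPositiveInVars (2 * k + 1) C.schur := by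
  classical
  intro hpos
  have hu : 0 < n - k := by omega
  obtain ⟨a, b, h⟩ := C.exists_hasBounds hu hC hskew
  obtain ⟨q₀, r, s, p, q, hrs, hqk, hP⟩ := h.exists_isCylProfile hu
  -- The bound q ≤ k from toricity makes `2 * k + 1` variables enough for the `k + 1 + q` letters.
  obtain ⟨ν, hν, hneg⟩ := exists_sum_isWrapped_neg (N := 2 * k + 1) hP (by omega)
  have h1 := altCoeff_nonneg_of_schurPositive hν hpos
  rw [altCoeff_eq_sum (CylindricSkewShape.coeff_schur h hu q₀)] at h1
  rw [← hrs] at hneg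
  exact absurd h1 (not_le.2 (Int.cast_lt_zero.2 hneg))
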